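/- For $N\ge 1$ let $\mathbf{SP}(N)$ be the spider with $N$ legs, i.e. the graph whose vertices are $v_N(r,j)$, $r=0,1,2,\dots$, $j=1,\dots,N$, where $v_N(0,1)=\dots=v_N(0,N)$ is a single vertex (the body), with $v_N(r,j)$ joined to $v_N(r+1,j)$. Let $\mathbf S_0,\mathbf S_1,\mathbf S_2,\dots$ be the Markov chain on $\mathbf{SP}(N)$ that starts from the body, moves from the body to $v_N(1,j)$ with probability $1/N$ for each $j$, and moves from $v_N(r,j)$, $r\ge 1$, to each of $v_N(r+1,j)$ and $v_N(r-1,j)$ with probability $1/2$. Write $\mathbf P$ for its law, $\xi(v_N(r,j),n)=\#\{i:\ 0\le i\le n,\ \mathbf S_i=v_N(r,j)\}$ and $$A(n,L,k)=\Big\{\min_{1\le j\le N}\xi(v_N(L,j),n)\ge k\Big\},$$ the event that in $n$ steps each leg is visited at height $L$ at least $k$ times. Let $c>0$ be a real number, let $k\ge 1$ be an integer, and let $L=L(N)$ be positive integers with $L(N)\le N/\log N$ for all sufficiently large $N$. Then $$\lim_{N\to\infty}\mathbf P\Big(A\big([(c\,L\,N\log N)^2],\,L,\,k\big)\Big)=P\Big(|Z|>\frac1c\Big),$$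 where $[\cdot]$ is the integer part and $Z$ is a standard normal random variable. -/

import Mathlib

open MeasureTheory ProbabilityTheory Filter Topology

/-- The vertices of the spider with `N` legs: the body, and on each leg `j` one vertex
`leg r j` at height `r + 1` for every natural number `r`. -/
inductive SpiderVertex (N : ℕ) : Type
  | body : SpiderVertex N
  | leg (r : ℕ) (j : Fin N) : SpiderVertex N
  deriving DecidableEq

namespace SpiderVertex

/-- The vertex `v(r, j)` at height `r` on leg `j`; all the `v(0, j)` are the body. -/
def v {N : ℕ} : ℕ → Fin N → SpiderVertex N
  | 0, _ => body
  | r + 1, j => leg r j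

/-- Events about vertices are arbitrary sets of vertices (the vertex set is countable). -/
instance instMeasurableSpace (N : ℕ) : MeasurableSpace (SpiderVertex N) := ⊤

end SpiderVertex

/-- One-step transition probabilities of the spider walk with leg probabilities `p`: from the body
the walk goes to `v(1, j)` with probability `p j`, and from `v(r, j)`, `r ≥ 1`, it goes to each of
`v(r + 1, j)` and `v(r - 1, j)` with probability `1 / 2`. -/
noncomputable def spiderStep {N : ℕ} (p : Fin N → ℝ) : SpiderVertex N → SpiderVertex N → ℝ
  | .body, .body => 0
  | .body, .leg r j => if r = 0 then p j else 0
  | .leg r j, y => if y = SpiderVertex.v (r + 2) j ∨ y = SpiderVertex.v r j then 1 / 2 else 0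

/-- `S` is, under `μ`, the Markov chain on the spider with `N` legs that starts from the body and
has the transition probabilities `spiderStep p`. -/
structure IsSpiderWalk {N : ℕ} (p : Fin N → ℝ) {Ω : Type*} [MeasurableSpace Ω] (μ : Measure Ω)
    (S : ℕ → Ω → SpiderVertex N) : Prop where
  measurable : ∀ n, Measurable (S n)
  start : ∀ᵐ ω ∂μ, S 0 ω = SpiderVertex.body
  step : ∀ (n : ℕ) (x : ℕ → SpiderVertex N),
    μ.real {ω | ∀ i ≤ n + 1, S i ω = x i} =
      μ.real {ω | ∀ i ≤ n, S i ω = x i} * spiderStep p (x n) (x (n + 1))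

/-- The local time `ξ(x, n)`: the number of times `i ≤ n` at which the path `s` is at `x`. -/
def spiderLocalTime {N : ℕ} (s : ℕ → SpiderVertex N) (x : SpiderVertex N) (n : ℕ) : ℕ :=
  ((Finset.range (n + 1)).filter fun i => s i = x).card

/-- The event `A(n, L, k)` that within `n` steps each leg is visited at height `L` at least
`k` times. -/
def spiderVisitEvent {N : ℕ} {Ω : Type*} (S : ℕ → Ω → SpiderVertex N) (n L k : ℕ) : Set Ω :=
  {ω | ∀ j : Fin N, k ≤ spiderLocalTime (fun i => S i ω) (SpiderVertex.v L j) n}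

/-! Count excursions from the body instead of steps. One excursion reaches height `L` of a given leg
with probability `1 / (N L)`, so covering all legs is a coupon collector problem whose threshold is
`T = N L log N` excursions (`coverScale`). Asking for `k` visits does not move this threshold to
first order. The limit therefore comes from the probability that `[(c T)^2]` steps contain about `T`
excursions.

That number has an exact law. The height is a reflected simple walk, and deleting the forced steps
out of the body turns the event of `m + 1` body visits before time `n` into the event that a simple
walk reaches level `m` within `n - (m + 1)` steps (`spiderExp_excursionCount_start`). With the
reflection formula and characteristic functions, `m` near `b T` gives the limit `P(|Z| > b / c)`
(`tendsto_srwMaxTail_floor`).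

The threshold has two sides. For `b > 1`, an exponential supermartingale and a union bound over the
legs show that `b T` excursions suffice (`spiderExp_few_visits_le`). For `b < 1`, a second moment
bound on the number of missed legs, which are negatively correlated, shows that they do not
(`spiderExp_all_visited_le`). Letting `b` tend to `1` and using continuity of the normal tail
finishes the proof. All expectations are finite iterated means over paths (`spiderExp`), so no
conditional expectations or stopping times occur. -/

/-- The mean of `g` after one step of the uniform spider walk. -/
noncomputable def spiderMean {N : ℕ} (g : SpiderVertex N → ℝ) : SpiderVertex N → ℝ
  | .body => (1 / (N : ℝ)) * ∑ j, g (.leg 0 j)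
  | .leg r j => (g (.leg (r + 1) j) + g (SpiderVertex.v r j)) / 2

/-- The conditional mean of the path functional `F` after `d` further steps of the uniform spider
walk, when the path up to time `t` is that of `s`. -/
noncomputable def spiderExp {N : ℕ} (F : (ℕ → SpiderVertex N) → ℝ) :
    ℕ → ℕ → (ℕ → SpiderVertex N) → ℝ
  | 0, _, s => F s
  | d + 1, t, s =>
      spiderMean (fun y => spiderExp F d (t + 1) (Function.update s (t + 1) y)) (s t)

/-! ### Iterated one-step means and discrete martingales. -/

section Mean

variable {N : ℕ}

theorem spiderMean_mono {g h : SpiderVertex N → ℝ} (hgh : ∀ y, g y ≤ h y) (x : SpiderVertex N) :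
    spiderMean g x ≤ spiderMean h x := by
  cases x with
  | body => exact mul_le_mul_of_nonneg_left (Finset.sum_le_sum fun j _ => hgh _) (by positivity)
  | leg r j =>
    have h1 := hgh (.leg (r + 1) j)
    have h2 := hgh (SpiderVertex.v r j)
    simp only [spiderMean]
    linarith

theorem spiderMean_add (g h : SpiderVertex N → ℝ) (x : SpiderVertex N) :
    spiderMean (fun y => g y + h y) x = spiderMean g x + spiderMean h x := by
  cases x with
  | body => simp only [spiderMean, Finset.sum_add_distrib]; ring
  | leg r j => simp only [spiderMean]; ring

theorem spiderMean_const_mul (a : ℝ) (g : SpiderVertex N → ℝ) (x : SpiderVertex N) :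
    spiderMean (fun y => a * g y) x = a * spiderMean g x := by
  cases x with
  | body => simp only [spiderMean, ← Finset.mul_sum]; ring
  | leg r j => simp only [spiderMean]; ring

theorem spiderMean_const (hN : N ≠ 0) (a : ℝ) (x : SpiderVertex N) :
    spiderMean (fun _ => a) x = a := by
  have : (N : ℝ) ≠ 0 := by exact_mod_cast hN
  cases x with
  | body => simp [spiderMean]; field_simp
  | leg r j => simp [spiderMean]

theorem spiderExp_mono {F G : (ℕ → SpiderVertex N) → ℝ} (hFG : ∀ s, F s ≤ G s) (d : ℕ) :
    ∀ t s, spiderExp F d t s ≤ spiderExp G d t s := by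
  induction d with
  | zero => intro t s; exact hFG s
  | succ d ih => intro t s; exact spiderMean_mono (fun y => ih _ _) _

theorem spiderExp_add (F G : (ℕ → SpiderVertex N) → ℝ) (d : ℕ) :
    ∀ t s, spiderExp (fun s => F s + G s) d t s = spiderExp F d t s + spiderExp G d t s := by
  induction d with
  | zero => intro t s; rfl
  | succ d ih => intro t s; simp only [spiderExp, ih, spiderMean_add]

theorem spiderExp_const_mul (a : ℝ) (F : (ℕ → SpiderVertex N) → ℝ) (d : ℕ) :
    ∀ t s, spiderExp (fun s => a * F s) d t s = a * spiderExp F d t s := by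
  induction d with
  | zero => intro t s; rfl
  | succ d ih => intro t s; simp only [spiderExp, ih, spiderMean_const_mul]

theorem spiderExp_const (hN : N ≠ 0) (a : ℝ) (d : ℕ) :
    ∀ t (s : ℕ → SpiderVertex N), spiderExp (fun _ => a) d t s = a := by
  induction d with
  | zero => intro t s; rfl
  | succ d ih => intro t s; simp only [spiderExp, ih, spiderMean_const hN]

theorem spiderExp_sum {ι : Type*} (I : Finset ι) (F : ι → (ℕ → SpiderVertex N) → ℝ) (d t : ℕ)
    (s : ℕ → SpiderVertex N) :
    spiderExp (fun s => ∑ i ∈ I, F i s) d t s = ∑ i ∈ I, spiderExp (F i) d t s := by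
  classical
  induction I using Finset.induction_on with
  | empty =>
    have := spiderExp_const_mul 0 (fun _ : ℕ → SpiderVertex N => (0 : ℝ)) d t s
    simpa using this
  | insert i I hi ih => simp only [Finset.sum_insert hi, spiderExp_add, ih]

/-- Supermartingales have nonincreasing means. -/
theorem spiderExp_le_of_supermartingale {f : ℕ → (ℕ → SpiderVertex N) → ℝ}
    (hf : ∀ t s, spiderMean (fun y => f (t + 1) (Function.update s (t + 1) y)) (s t) ≤ f t s)
    (d : ℕ) : ∀ t s, spiderExp (f (t + d)) d t s ≤ f t s := by
  induction d with
  | zero => intro t s; exact le_rfl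
  | succ d ih =>
    intro t s
    refine le_trans (spiderMean_mono (fun y => ?_) _) (hf t s)
    have := ih (t + 1) (Function.update s (t + 1) y)
    rwa [show t + 1 + d = t + (d + 1) by ring] at this

/-- Martingales have constant means. -/
theorem spiderExp_eq_of_martingale {f : ℕ → (ℕ → SpiderVertex N) → ℝ}
    (hf : ∀ t s, spiderMean (fun y => f (t + 1) (Function.update s (t + 1) y)) (s t) = f t s)
    (d : ℕ) (t : ℕ) (s : ℕ → SpiderVertex N) : spiderExp (f (t + d)) d t s = f t s := by
  refine le_antisymm (spiderExp_le_of_supermartingale (fun t s => (hf t s).le) d t s) ?_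
  have := spiderExp_le_of_supermartingale (f := fun t s => -1 * f t s)
    (fun t s => by rw [spiderMean_const_mul, hf]) d t s
  rw [spiderExp_const_mul] at this
  linarith

end Mean

/-! ### From the law of the walk to iterated means. -/

section Law

variable {N : ℕ}

instance SpiderVertex.instCountable : Countable (SpiderVertex N) := by
  refine Function.Injective.countable
    (f := fun x : SpiderVertex N => match x with
      | .body => (none : Option (ℕ × Fin N))
      | .leg r j => some (r, j)) ?_
  intro x y h
  cases x <;> cases y <;> simp_all

instance SpiderVertex.instMeasurableSingletonClass : MeasurableSingletonClass (SpiderVertex N) :=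
  ⟨fun _ => trivial⟩

/-- `B` depends only on the path up to time `n`. -/
def PathDeterminedBy (n : ℕ) (B : Set (ℕ → SpiderVertex N)) : Prop :=
  ∀ s s', (∀ i ≤ n, s i = s' i) → (s ∈ B ↔ s' ∈ B)

theorem PathDeterminedBy.compl {n : ℕ} {B : Set (ℕ → SpiderVertex N)}
    (hB : PathDeterminedBy n B) : PathDeterminedBy n Bᶜ :=
  fun s s' h => not_congr (hB s s' h)

variable {Ω : Type*} [MeasurableSpace Ω] {μ : Measure Ω} {S : ℕ → Ω → SpiderVertex N}

/-- The event is a preimage under the first `n + 1` coordinates, which take values in a countable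
space where every set is measurable. -/
theorem PathDeterminedBy.measurableSet {n : ℕ} {B : Set (ℕ → SpiderVertex N)}
    (hB : PathDeterminedBy n B) (hS : ∀ n, Measurable (S n)) :
    MeasurableSet {ω | (fun i => S i ω) ∈ B} := by
  let T : Ω → (Fin (n + 1) → SpiderVertex N) := fun ω i => S i ω
  have hT : Measurable T := measurable_pi_lambda _ fun i => hS i
  have hD : {ω | (fun i => S i ω) ∈ B} = T ⁻¹' (T '' {ω | (fun i => S i ω) ∈ B}) := by
    refine Set.Subset.antisymm (Set.subset_preimage_image _ _) ?_
    rintro ω ⟨ω', h', hω⟩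
    refine (hB _ _ fun i hi => ?_).1 h'
    exact congrFun hω ⟨i, by omega⟩
  rw [hD]
  exact hT (Set.to_countable _).measurableSet

theorem measurableSet_prefix (hS : ∀ n, Measurable (S n)) (t : ℕ) (x : ℕ → SpiderVertex N) :
    MeasurableSet {ω | ∀ i ≤ t, S i ω = x i} := by
  have : {ω | ∀ i ≤ t, S i ω = x i} = ⋂ i ∈ Set.Iic t, (S i) ⁻¹' {x i} := by
    ext; simp
  rw [this]
  exact MeasurableSet.biInter (Set.to_countable _) fun i _ => hS i (measurableSet_singleton _)

/-- The vertices that the spider walk can reach from a vertex in one step. -/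
def SpiderVertex.next : SpiderVertex N → Finset (SpiderVertex N)
  | .body => Finset.univ.image fun j => .leg 0 j
  | .leg r j => {SpiderVertex.leg (r + 1) j, SpiderVertex.v r j}

theorem SpiderVertex.leg_ne_v (r : ℕ) (j : Fin N) : SpiderVertex.leg (r + 1) j ≠ v r j := by
  cases r with
  | zero => simp [v]
  | succ r => simp only [v, ne_eq, leg.injEq, and_true]; omega

theorem spiderMean_eq_sum (g : SpiderVertex N → ℝ) (x : SpiderVertex N) :
    spiderMean g x = ∑ y ∈ x.next, spiderStep (fun _ => 1 / (N : ℝ)) x y * g y := by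
  cases x with
  | body =>
    rw [SpiderVertex.next, Finset.sum_image (by intro a _ b _ h; simpa using h)]
    simp [spiderMean, spiderStep, Finset.mul_sum]
  | leg r j =>
    rw [SpiderVertex.next, Finset.sum_pair (SpiderVertex.leg_ne_v r j)]
    simp [spiderMean, spiderStep, SpiderVertex.v]
    ring

/-- An inequality is enough: summing over the possible next vertices ignores the null event of a
forbidden jump, and the complementary event later supplies the reverse bound. -/
theorem IsSpiderWalk.le_measureReal_prefix_inter [IsProbabilityMeasure μ]
    (hS : IsSpiderWalk (fun _ : Fin N => 1 / (N : ℝ)) μ S)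
    {B : Set (ℕ → SpiderVertex N)} (d : ℕ) :
    ∀ t, PathDeterminedBy (t + d) B → ∀ x : ℕ → SpiderVertex N,
      μ.real {ω | ∀ i ≤ t, S i ω = x i} * spiderExp (B.indicator 1) d t x ≤
        μ.real ({ω | ∀ i ≤ t, S i ω = x i} ∩ {ω | (fun i => S i ω) ∈ B}) := by
  induction d with
  | zero =>
    intro t hB x
    by_cases hx : x ∈ B
    · simp only [spiderExp, Set.indicator_of_mem hx, Pi.one_apply, mul_one]
      refine measureReal_mono fun ω hω => ⟨hω, ?_⟩
      exact (hB _ _ hω).2 hx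
    · simp only [spiderExp, Set.indicator_of_notMem hx, mul_zero]
      exact measureReal_nonneg
  | succ d ih =>
    intro t hB x
    have hB' : PathDeterminedBy (t + 1 + d) B := by
      rwa [show t + 1 + d = t + (d + 1) by ring]
    have hD := hB.measurableSet hS.measurable
    set D := {ω | (fun i => S i ω) ∈ B} with hDdef
    let C : SpiderVertex N → Set Ω :=
      fun y => {ω | ∀ i ≤ t + 1, S i ω = Function.update x (t + 1) y i}
    have hCm : ∀ y, MeasurableSet (C y ∩ D) := fun y =>
      (measurableSet_prefix hS.measurable _ _).inter hD
    have hsplit : ∀ y ω, ω ∈ C y → (∀ i ≤ t, S i ω = x i) ∧ S (t + 1) ω = y := by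
      intro y ω h
      refine ⟨fun i hi => ?_, ?_⟩
      · rw [h i (by omega), Function.update_of_ne (by omega)]
      · rw [h (t + 1) le_rfl, Function.update_self]
    have hstep : ∀ y, μ.real (C y) = μ.real {ω | ∀ i ≤ t, S i ω = x i} *
        spiderStep (fun _ => 1 / (N : ℝ)) (x t) y := by
      intro y
      have h := hS.step t (Function.update x (t + 1) y)
      rw [Function.update_self, Function.update_of_ne (by omega)] at h
      rw [h]
      congr 3
      ext ω
      refine forall₂_congr fun i hi => ?_
      rw [Function.update_of_ne (by omega)]
    have hdisj : Set.PairwiseDisjoint (↑(x t).next : Set (SpiderVertex N)) fun y => C y ∩ D := by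
      intro y _ z _ hyz
      refine Set.disjoint_left.2 fun ω h1 h2 => hyz ?_
      rw [← (hsplit y ω h1.1).2, (hsplit z ω h2.1).2]
    calc μ.real {ω | ∀ i ≤ t, S i ω = x i} * spiderExp (B.indicator 1) (d + 1) t x
        = ∑ y ∈ (x t).next, μ.real (C y) *
            spiderExp (B.indicator 1) d (t + 1) (Function.update x (t + 1) y) := by
          rw [spiderExp, spiderMean_eq_sum, Finset.mul_sum]
          refine Finset.sum_congr rfl fun y _ => ?_
          rw [hstep, mul_assoc]
      _ ≤ ∑ y ∈ (x t).next, μ.real (C y ∩ D) := Finset.sum_le_sum fun y _ => ih _ hB' _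
      _ = μ.real (⋃ y ∈ (x t).next, C y ∩ D) :=
          (measureReal_biUnion_finset hdisj fun y _ => hCm y).symm
      _ ≤ _ := by
          refine measureReal_mono ?_
          intro ω hω
          simp only [Set.mem_iUnion] at hω
          obtain ⟨y, _, h1, h2⟩ := hω
          exact ⟨(hsplit y ω h1).1, h2⟩

/-- Probabilities of events up to time `n` are computed by `spiderExp`. -/
theorem IsSpiderWalk.measureReal_eq_spiderExp [IsProbabilityMeasure μ] (hN : N ≠ 0)
    (hS : IsSpiderWalk (fun _ : Fin N => 1 / (N : ℝ)) μ S)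
    {B : Set (ℕ → SpiderVertex N)} {n : ℕ} (hB : PathDeterminedBy n B) :
    μ.real {ω | (fun i => S i ω) ∈ B} = spiderExp (B.indicator 1) n 0 fun _ => .body := by
  have hstart : μ.real {ω | ∀ i ≤ 0, S i ω = (fun _ => SpiderVertex.body) i} = 1 := by
    have : {ω | ∀ i ≤ 0, S i ω = (fun _ => SpiderVertex.body) i} =ᵐ[μ] Set.univ := by
      refine eventuallyEq_univ.2 ?_
      filter_upwards [hS.start] with ω hω i hi
      rw [Nat.le_zero.1 hi, hω]
    rw [measureReal_congr this]
    simp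
  have key : ∀ {B : Set (ℕ → SpiderVertex N)}, PathDeterminedBy n B →
      spiderExp (B.indicator 1) n 0 (fun _ => .body) ≤ μ.real {ω | (fun i => S i ω) ∈ B} := by
    intro B hB
    have h := hS.le_measureReal_prefix_inter n 0 (by rwa [zero_add]) fun _ => .body
    rw [hstart, one_mul] at h
    exact h.trans (measureReal_mono Set.inter_subset_right)
  refine le_antisymm ?_ (key hB)
  -- The lower bounds for `B` and its complement add up to one, so both are equalities.
  have h := key hB.compl
  have hc : {ω | (fun i => S i ω) ∈ Bᶜ} = {ω | (fun i => S i ω) ∈ B}ᶜ := rfl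
  rw [hc, probReal_compl_eq_one_sub (hB.measurableSet hS.measurable)] at h
  have hadd := spiderExp_add (B.indicator 1) (Bᶜ.indicator 1) n 0 fun _ => .body
  have hone : (fun s => B.indicator (1 : (ℕ → SpiderVertex N) → ℝ) s + Bᶜ.indicator 1 s) =
      fun _ => 1 := by
    ext s
    by_cases hs : s ∈ B <;> simp [hs]
  rw [hone, spiderExp_const hN] at hadd
  linarith

end Law

/-! ### Counting excursions and visits along a path. -/

section Counters

variable {N : ℕ}

/-- The number of visits to the body before time `t`, i.e. the number of excursions started. -/
def excursionCount (s : ℕ → SpiderVertex N) (t : ℕ) : ℕ :=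
  ((Finset.range t).filter fun i => s i = .body).card

/-- The number of visits to `x` up to time `t` during the first `m` excursions. -/
def earlyVisits (m : ℕ) (x : SpiderVertex N) (s : ℕ → SpiderVertex N) (t : ℕ) : ℕ :=
  ((Finset.range (t + 1)).filter fun i => s i = x ∧ excursionCount s i ≤ m).card

theorem excursionCount_congr {s s' : ℕ → SpiderVertex N} {t : ℕ} (h : ∀ i < t, s i = s' i) :
    excursionCount s t = excursionCount s' t := by
  unfold excursionCount
  congr 1
  refine Finset.filter_congr fun i hi => ?_
  rw [h i (Finset.mem_range.1 hi)]

theorem spiderLocalTime_congr {s s' : ℕ → SpiderVertex N} {t : ℕ} (h : ∀ i ≤ t, s i = s' i)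
    (x : SpiderVertex N) : spiderLocalTime s x t = spiderLocalTime s' x t := by
  unfold spiderLocalTime
  congr 1
  refine Finset.filter_congr fun i hi => ?_
  rw [h i (Nat.lt_succ_iff.1 (Finset.mem_range.1 hi))]

theorem earlyVisits_congr {s s' : ℕ → SpiderVertex N} {t : ℕ} (h : ∀ i ≤ t, s i = s' i)
    (m : ℕ) (x : SpiderVertex N) : earlyVisits m x s t = earlyVisits m x s' t := by
  unfold earlyVisits
  congr 1
  refine Finset.filter_congr fun i hi => ?_
  have hi' := Nat.lt_succ_iff.1 (Finset.mem_range.1 hi)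
  rw [h i hi', excursionCount_congr fun i' hi'' => h i' (by omega)]

theorem update_eq_of_le (s : ℕ → SpiderVertex N) (t : ℕ) (y : SpiderVertex N) :
    ∀ i ≤ t, Function.update s (t + 1) y i = s i :=
  fun i hi => Function.update_of_ne (by omega) _ _

theorem excursionCount_succ (s : ℕ → SpiderVertex N) (t : ℕ) :
    excursionCount s (t + 1) = excursionCount s t + if s t = .body then 1 else 0 := by
  unfold excursionCount
  rw [Finset.range_add_one, Finset.filter_insert]
  split_ifs with h
  · rw [Finset.card_insert_of_notMem (by simp)]
  · rfl

/-- The count at time `t + 1` looks only at times up to `t`, so it is predictable: the new vertex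
`y` does not enter. -/
theorem excursionCount_update (s : ℕ → SpiderVertex N) (t : ℕ) (y : SpiderVertex N) :
    excursionCount (Function.update s (t + 1) y) (t + 1) =
      excursionCount s t + if s t = .body then 1 else 0 := by
  rw [← excursionCount_succ]
  exact excursionCount_congr fun i hi => update_eq_of_le s t y i (by omega)

theorem excursionCount_mono (s : ℕ → SpiderVertex N) : Monotone (excursionCount s) :=
  fun _ _ h => Finset.card_le_card
    (Finset.filter_subset_filter _ (Finset.range_subset_range.2 h))

theorem spiderLocalTime_update (s : ℕ → SpiderVertex N) (x : SpiderVertex N) (t : ℕ)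
    (y : SpiderVertex N) :
    spiderLocalTime (Function.update s (t + 1) y) x (t + 1) =
      spiderLocalTime s x t + if y = x then 1 else 0 := by
  rw [← spiderLocalTime_congr (update_eq_of_le s t y)]
  unfold spiderLocalTime
  rw [Finset.range_add_one (n := t + 1), Finset.filter_insert, Function.update_self]
  split_ifs with h
  · rw [Finset.card_insert_of_notMem (by simp)]
  · rfl

theorem earlyVisits_update (m : ℕ) (s : ℕ → SpiderVertex N) (x : SpiderVertex N) (t : ℕ)
    (y : SpiderVertex N) :
    earlyVisits m x (Function.update s (t + 1) y) (t + 1) = earlyVisits m x s t +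
      if y = x ∧ excursionCount s (t + 1) ≤ m then 1 else 0 := by
  rw [← earlyVisits_congr (update_eq_of_le s t y), excursionCount_succ,
    ← excursionCount_update s t y]
  unfold earlyVisits
  rw [Finset.range_add_one (n := t + 1), Finset.filter_insert, Function.update_self]
  split_ifs with h
  · rw [Finset.card_insert_of_notMem (by simp)]
  · rfl

theorem earlyVisits_eq_spiderLocalTime {m : ℕ} {s : ℕ → SpiderVertex N} {n : ℕ}
    (h : excursionCount s n ≤ m) (x : SpiderVertex N) :
    earlyVisits m x s n = spiderLocalTime s x n := by
  unfold earlyVisits spiderLocalTime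
  congr 1
  refine Finset.filter_congr fun i hi => ?_
  have hi' := Nat.lt_succ_iff.1 (Finset.mem_range.1 hi)
  simp [(excursionCount_mono s hi').trans h]

theorem earlyVisits_pos {m : ℕ} {s : ℕ → SpiderVertex N} {t : ℕ}
    (h : excursionCount s t ≤ m) : earlyVisits m (s t) s t ≠ 0 :=
  Finset.card_ne_zero.2 ⟨t, by simp [h]⟩

end Counters

/-! ### Many excursions give every leg its visits: an exponential supermartingale. -/

section FewVisits

variable {N : ℕ}

/-- A lower bound for the mean of `θ` to the number of visits at height `L` of leg `j` during the
rest of the present excursion. -/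
noncomputable def legDiscount (L : ℕ) (θ : ℝ) (j : Fin N) : SpiderVertex N → ℝ
  | .body => 1
  | .leg r i => if i = j ∧ r + 1 < L then 1 - (r + 1) / L * (1 - θ) else 1

theorem le_legDiscount {L : ℕ} (hL : 1 ≤ L) {θ : ℝ} (h1 : θ ≤ 1) (j : Fin N)
    (x : SpiderVertex N) : θ ≤ legDiscount L θ j x := by
  cases x with
  | body => exact h1
  | leg r i =>
    simp only [legDiscount]
    split_ifs with h
    · have hL' : (0 : ℝ) < L := by exact_mod_cast hL
      have : ((r : ℝ) + 1) / L ≤ 1 := by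
        rw [div_le_one hL']
        exact_mod_cast h.2.le
      nlinarith
    · exact h1

/-- The one-step inequality behind the supermartingale `θ ^ ξ * legDiscount * β ^ (-excursions)`. -/
theorem spiderMean_legDiscount_le (hN : N ≠ 0) {L : ℕ} (hL : 1 ≤ L) {θ : ℝ}
    (h1 : θ ≤ 1) (j : Fin N) (x : SpiderVertex N) :
    spiderMean (fun y => (if y = SpiderVertex.v L j then θ else 1) * legDiscount L θ j y) x ≤
      (if x = .body then 1 - (1 - θ) / (N * L) else 1) * legDiscount L θ j x := by
  have hL' : (0 : ℝ) < L := by exact_mod_cast hL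
  have hN' : (N : ℝ) ≠ 0 := by exact_mod_cast hN
  obtain ⟨l, rfl⟩ : ∃ l, L = l + 1 := ⟨L - 1, by omega⟩
  set χ : SpiderVertex N → ℝ :=
    fun y => (if y = SpiderVertex.v (l + 1) j then θ else 1) * legDiscount (l + 1) θ j y with hχ
  have hbody : χ .body = 1 := by simp [hχ, SpiderVertex.v, legDiscount]
  have hother : ∀ r i, i ≠ j → χ (.leg r i) = 1 := by
    intro r i hi
    simp [hχ, SpiderVertex.v, legDiscount, hi]
  -- The linear profile also holds at height `L` itself, where the factor `θ` of the visit replaces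
  -- `legDiscount`; hence the mean is exact at every height below `L`.
  have hlow : ∀ r, r ≤ l → χ (.leg r j) = 1 - (r + 1) / (l + 1) * (1 - θ) := by
    intro r hr
    rcases hr.lt_or_eq with h | rfl
    · simp [hχ, SpiderVertex.v, legDiscount, h, h.ne]
    · have : (r : ℝ) + 1 ≠ 0 := by positivity
      simp [hχ, SpiderVertex.v, legDiscount, this]
  have hhigh : ∀ r, l < r → χ (.leg r j) = 1 := by
    intro r hr
    simp [hχ, SpiderVertex.v, legDiscount, hr.ne', hr.not_gt]
  have hle : ∀ y, χ y ≤ 1 := by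
    intro y
    cases y with
    | body => exact hbody.le
    | leg r i =>
      by_cases hi : i = j
      · subst hi
        rcases le_or_gt r l with h | h
        · rw [hlow r h]
          have : 0 ≤ ((r : ℝ) + 1) / (l + 1) * (1 - θ) :=
            mul_nonneg (by positivity) (by linarith)
          linarith
        · exact (hhigh r h).le
      · exact (hother r i hi).le
  cases x with
  | body =>
    have hsum : ∑ i, χ (.leg 0 i) = N - (1 - θ) / (l + 1) := by
      have : ∀ i, χ (.leg 0 i) = 1 - if i = j then (1 - θ) / (l + 1) else 0 := by
        intro i
        by_cases hi : i = j
        · subst hi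
          rw [hlow 0 (Nat.zero_le _)]
          simp; ring
        · simp [hother 0 i hi, hi]
      simp [this]
    simp only [spiderMean, hsum, if_true, legDiscount]
    push_cast
    refine le_of_eq ?_
    field_simp
  | leg r i =>
    simp only [spiderMean, reduceCtorEq, if_false, one_mul]
    by_cases hi : i = j
    · subst hi
      by_cases hr : r < l
      · have hv : χ (SpiderVertex.v r i) = 1 - r / (l + 1) * (1 - θ) := by
          cases r with
          | zero => simp [SpiderVertex.v, hbody]
          | succ r => rw [SpiderVertex.v, hlow r (by omega)]; push_cast; ring
        rw [hlow (r + 1) hr, hv, legDiscount, if_pos ⟨rfl, by omega⟩]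
        push_cast
        refine le_of_eq ?_
        ring
      -- From height `L` on, the right side is `1` and `χ ≤ 1` is all that is used: further visits
      -- in the same excursion are not exploited.
      · rw [legDiscount, if_neg (by omega)]
        linarith [hle (.leg (r + 1) i), hle (SpiderVertex.v r i)]
    · rw [legDiscount, if_neg (by tauto)]
      linarith [hle (.leg (r + 1) i), hle (SpiderVertex.v r i)]

/-- It is unlikely that a leg has few visits at height `L` after many excursions. -/
theorem spiderExp_few_visits_le (hN : N ≠ 0) {L : ℕ} (hL : 1 ≤ L) {θ : ℝ} (h0 : 0 < θ)
    (h1 : θ ≤ 1) (j : Fin N) (k m n : ℕ) :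
    spiderExp (Set.indicator {s | m ≤ excursionCount s n ∧
      spiderLocalTime s (SpiderVertex.v L j) n < k} 1) n 0 (fun _ => .body) ≤
      (θ ^ (k + 1))⁻¹ * (1 - (1 - θ) / (N * L)) ^ m := by
  have hL' : (1 : ℝ) ≤ L := by exact_mod_cast hL
  have hN' : (1 : ℝ) ≤ N := by exact_mod_cast Nat.one_le_iff_ne_zero.2 hN
  set β : ℝ := 1 - (1 - θ) / (N * L) with hβ
  have hβ0 : 0 < β := by
    have : (1 - θ) / (N * L) ≤ 1 - θ :=
      div_le_self (by linarith) (by nlinarith)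
    linarith
  have hβ1 : β ≤ 1 := by
    have : 0 ≤ (1 - θ) / (N * L) := div_nonneg (by linarith) (by positivity)
    linarith
  let W : ℕ → (ℕ → SpiderVertex N) → ℝ := fun t s =>
    (θ ^ spiderLocalTime s (SpiderVertex.v L j) t * (β⁻¹) ^ excursionCount s t) *
      legDiscount L θ j (s t)
  have hW : ∀ t s,
      spiderMean (fun y => W (t + 1) (Function.update s (t + 1) y)) (s t) ≤ W t s := by
    intro t s
    have hfun : (fun y => W (t + 1) (Function.update s (t + 1) y)) = fun y =>
        (θ ^ spiderLocalTime s (SpiderVertex.v L j) t *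
          (β⁻¹) ^ (excursionCount s t + if s t = .body then 1 else 0)) *
        ((if y = SpiderVertex.v L j then θ else 1) * legDiscount L θ j y) := by
      ext y
      simp only [W, spiderLocalTime_update, excursionCount_update, Function.update_self]
      split_ifs <;> ring
    rw [hfun, spiderMean_const_mul]
    refine (mul_le_mul_of_nonneg_left (spiderMean_legDiscount_le hN hL h1 j (s t))
      (by positivity)).trans (le_of_eq ?_)
    simp only [W, ← hβ]
    split_ifs
    · rw [pow_succ]; field_simp
    · ring
  have hstart : W 0 (fun _ => .body) = 1 := by
    obtain ⟨l, rfl⟩ : ∃ l, L = l + 1 := ⟨L - 1, by omega⟩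
    simp [W, excursionCount, spiderLocalTime, SpiderVertex.v, legDiscount]
  have hmean := spiderExp_le_of_supermartingale hW n 0 fun _ => .body
  rw [zero_add, hstart] at hmean
  refine (spiderExp_mono (G := fun s => ((θ ^ (k + 1))⁻¹ * β ^ m) * W n s) (fun s => ?_) n 0 _).trans
    ?_
  · have hWnn : 0 ≤ W n s := mul_nonneg (by positivity)
      (h0.le.trans (le_legDiscount hL h1 j _))
    by_cases hs : m ≤ excursionCount s n ∧ spiderLocalTime s (SpiderVertex.v L j) n < k
    · rw [Set.indicator_of_mem (by exact hs), Pi.one_apply]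
      have e1 : θ ^ k ≤ θ ^ spiderLocalTime s (SpiderVertex.v L j) n :=
        pow_le_pow_of_le_one h0.le h1 hs.2.le
      have e2 : (β⁻¹) ^ m ≤ (β⁻¹) ^ excursionCount s n :=
        pow_le_pow_right₀ ((one_le_inv₀ hβ0).2 hβ1) hs.1
      -- The extra `θ` bounds `legDiscount` below, since time `n` may fall inside an excursion; it
      -- accounts for the exponent `k + 1`.
      have e3 : θ ^ k * (β⁻¹) ^ m * θ ≤ W n s :=
        mul_le_mul (mul_le_mul e1 e2 (by positivity) (by positivity)) (le_legDiscount hL h1 j _)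
          h0.le (by positivity)
      calc (1 : ℝ) = ((θ ^ (k + 1))⁻¹ * β ^ m) * (θ ^ k * (β⁻¹) ^ m * θ) := by
            rw [inv_pow, pow_succ]; field_simp
        _ ≤ _ := mul_le_mul_of_nonneg_left e3 (by positivity)
    · rw [Set.indicator_of_notMem (by exact hs)]
      positivity
  · rw [spiderExp_const_mul]
    exact mul_le_of_le_one_right (by positivity) hmean

end FewVisits

/-! ### Few excursions leave a leg unvisited: the second moment method. -/

section Missed

variable {N : ℕ}

/-- The probability of not visiting height `L` of leg `j` during the rest of the present excursion,
when it has not been visited yet. -/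
noncomputable def legMiss (L : ℕ) (j : Fin N) : SpiderVertex N → ℝ
  | .body => 1
  | .leg r i => if i = j then max 0 (1 - (r + 1) / L) else 1

theorem legMiss_nonneg (L : ℕ) (j : Fin N) (x : SpiderVertex N) : 0 ≤ legMiss L j x := by
  cases x with
  | body => exact zero_le_one
  | leg r i => simp only [legMiss]; split_ifs <;> simp

theorem legMiss_le_one (L : ℕ) (j : Fin N) (x : SpiderVertex N) : legMiss L j x ≤ 1 := by
  cases x with
  | body => exact le_rfl
  | leg r i =>
    simp only [legMiss]
    split_ifs
    · have : (0 : ℝ) ≤ ((r : ℝ) + 1) / L := by positivity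
      simp [this]
    · exact le_rfl

theorem legMiss_v_self {L : ℕ} (hL : 1 ≤ L) (j : Fin N) :
    legMiss L j (SpiderVertex.v L j) = 0 := by
  obtain ⟨l, rfl⟩ : ∃ l, L = l + 1 := ⟨L - 1, by omega⟩
  have : (l : ℝ) + 1 ≠ 0 := by positivity
  simp [SpiderVertex.v, legMiss, this]

/-- A vertex lies on at most one of the two legs, so one factor is `1` and `(1 - legMiss L i x) * (1
- legMiss L j x) = 0`. -/
theorem legMiss_mul {L : ℕ} {i j : Fin N} (hij : i ≠ j) (x : SpiderVertex N) :
    legMiss L i x * legMiss L j x = legMiss L i x + legMiss L j x - 1 := by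
  cases x with
  | body => norm_num [legMiss]
  | leg r l =>
    simp only [legMiss]
    by_cases hi : l = i
    · have hj : l ≠ j := fun h => hij (hi.symm.trans h)
      simp [hj]
    · simp [hi]

theorem spiderMean_legMiss_body (hN : N ≠ 0) {L : ℕ} (hL : 1 ≤ L) (j : Fin N) :
    spiderMean (legMiss L j) .body = 1 - 1 / (N * L) := by
  have hL' : (1 : ℝ) ≤ L := by exact_mod_cast hL
  have hN' : (N : ℝ) ≠ 0 := by exact_mod_cast hN
  have : ∀ i, legMiss L j (.leg 0 i) = 1 - if i = j then 1 / (L : ℝ) else 0 := by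
    intro i
    by_cases hi : i = j
    · have : (L : ℝ)⁻¹ ≤ 1 := inv_le_one_of_one_le₀ hL'
      simp [legMiss, hi, this]
    · simp [legMiss, hi]
  simp only [spiderMean, this, Finset.sum_sub_distrib]
  simp
  field_simp

/-- Along leg `j` the profile is linear below height `L` and zero above, so its only kink on the leg
is at the excluded height `L`. -/
theorem spiderMean_legMiss_of_ne {L : ℕ} (hL : 1 ≤ L) {j : Fin N} {x : SpiderVertex N}
    (hx : x ≠ .body) (hxL : x ≠ SpiderVertex.v L j) :
    spiderMean (legMiss L j) x = legMiss L j x := by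
  obtain ⟨l, rfl⟩ : ∃ l, L = l + 1 := ⟨L - 1, by omega⟩
  have hl : (0 : ℝ) < (l : ℝ) + 1 := by positivity
  cases x with
  | body => exact absurd rfl hx
  | leg r i =>
    by_cases hi : i = j
    · subst hi
      have hval : ∀ r : ℕ, legMiss (l + 1) i (SpiderVertex.v r i) =
          max 0 (1 - (r : ℝ) / (l + 1)) := by
        intro r
        cases r with
        | zero => simp [SpiderVertex.v, legMiss]
        | succ r => simp [SpiderVertex.v, legMiss]
      have hlow : ∀ r : ℕ, r ≤ l + 1 →
          legMiss (l + 1) i (SpiderVertex.v r i) = 1 - r / (l + 1) := by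
        intro r hr
        rw [hval, max_eq_right]
        have : (r : ℝ) / (l + 1) ≤ 1 := by
          rw [div_le_one hl]
          exact_mod_cast hr
        linarith
      have hhigh : ∀ r : ℕ, l + 1 ≤ r → legMiss (l + 1) i (SpiderVertex.v r i) = 0 := by
        intro r hr
        rw [hval, max_eq_left]
        have : 1 ≤ (r : ℝ) / (l + 1) := by
          rw [one_le_div hl]
          exact_mod_cast hr
        linarith
      have hne : r ≠ l := fun h => hxL (by rw [h]; rfl)
      change (legMiss (l + 1) i (SpiderVertex.v (r + 2) i) +
        legMiss (l + 1) i (SpiderVertex.v r i)) / 2 =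
          legMiss (l + 1) i (SpiderVertex.v (r + 1) i)
      rcases hne.lt_or_gt with h | h
      · rw [hlow _ (by omega), hlow _ (by omega), hlow _ (by omega)]
        push_cast
        ring
      · rw [hhigh _ (by omega), hhigh _ (by omega), hhigh _ (by omega)]
        norm_num
    · cases r with
      | zero => simp [spiderMean, legMiss, SpiderVertex.v, hi]
      | succ r => simp [spiderMean, legMiss, SpiderVertex.v, hi]

/-- The conditional probability, given the path up to time `t`, that leg `j` is not visited at
height `L` during the first `m` excursions. -/
noncomputable def missProb (L m : ℕ) (j : Fin N) (t : ℕ) (s : ℕ → SpiderVertex N) : ℝ :=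
  if earlyVisits m (SpiderVertex.v L j) s t = 0 then
    if excursionCount s t ≤ m then
      (1 - 1 / ((N : ℝ) * L)) ^ (m - excursionCount s t) * legMiss L j (s t)
    else 1
  else 0

theorem missProb_update {L : ℕ} (hL : 1 ≤ L) (m : ℕ) (j : Fin N) (t : ℕ)
    (s : ℕ → SpiderVertex N) (y : SpiderVertex N) :
    missProb L m j (t + 1) (Function.update s (t + 1) y) =
      if earlyVisits m (SpiderVertex.v L j) s t = 0 then
        if excursionCount s (t + 1) ≤ m then
          (1 - 1 / ((N : ℝ) * L)) ^ (m - excursionCount s (t + 1)) * legMiss L j y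
        else 1
      else 0 := by
  unfold missProb
  rw [earlyVisits_update, excursionCount_update, ← excursionCount_succ, Function.update_self]
  by_cases h0 : earlyVisits m (SpiderVertex.v L j) s t = 0
  · by_cases hm : excursionCount s (t + 1) ≤ m
    · by_cases hy : y = SpiderVertex.v L j
      · simp [h0, hm, hy, legMiss_v_self hL]
      · simp [h0, hm, hy]
    · simp [h0, hm]
  · simp [h0]

theorem one_sub_inv_mul_mem_Icc (N : ℕ) {L : ℕ} (hL : 1 ≤ L) :
    1 - 1 / ((N : ℝ) * L) ∈ Set.Icc (0 : ℝ) 1 := by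
  have hL' : (1 : ℝ) ≤ L := by exact_mod_cast hL
  have h0 : 0 ≤ 1 / ((N : ℝ) * L) := by positivity
  have h1 : 1 / ((N : ℝ) * L) ≤ 1 := by
    rcases Nat.eq_zero_or_pos N with rfl | h
    · simp
    · have hN' : (1 : ℝ) ≤ N := by exact_mod_cast h
      rw [div_le_one (by positivity)]
      nlinarith
  constructor <;> linarith

theorem missProb_mem_Icc {L : ℕ} (hL : 1 ≤ L) (m : ℕ) (j : Fin N) (t : ℕ)
    (s : ℕ → SpiderVertex N) : missProb L m j t s ∈ Set.Icc (0 : ℝ) 1 := by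
  have hβ := one_sub_inv_mul_mem_Icc N hL
  unfold missProb
  split_ifs
  · exact ⟨mul_nonneg (pow_nonneg hβ.1 _) (legMiss_nonneg _ _ _),
      mul_le_one₀ (pow_le_one₀ hβ.1 hβ.2) (legMiss_nonneg _ _ _) (legMiss_le_one _ _ _)⟩
  · simp
  · simp

theorem missProb_of_body {L m : ℕ} {j : Fin N} {t : ℕ} {s : ℕ → SpiderVertex N}
    (h0 : earlyVisits m (SpiderVertex.v L j) s t = 0) (hm : excursionCount s t ≤ m)
    (hs : s t = .body) :
    missProb L m j t s = (1 - 1 / ((N : ℝ) * L)) ^ (m - excursionCount s t) := by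
  simp [missProb, h0, hm, hs, legMiss]

theorem ne_v_of_earlyVisits_eq_zero {L m : ℕ} {j : Fin N} {t : ℕ} {s : ℕ → SpiderVertex N}
    (h0 : earlyVisits m (SpiderVertex.v L j) s t = 0) (hm : excursionCount s t ≤ m) :
    s t ≠ SpiderVertex.v L j :=
  fun h => earlyVisits_pos hm (h ▸ h0)

/-- Inside an excursion this is harmonicity of `legMiss`. At the body, the mean `1 - 1 / (N L)` of
`legMiss` supplies the factor of the excursion that starts, or nothing changes if the first `m` are
over. -/
theorem missProb_martingale (hN : N ≠ 0) {L : ℕ} (hL : 1 ≤ L) (m : ℕ) (j : Fin N) (t : ℕ)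
    (s : ℕ → SpiderVertex N) :
    spiderMean (fun y => missProb L m j (t + 1) (Function.update s (t + 1) y)) (s t) =
      missProb L m j t s := by
  simp only [missProb_update hL]
  by_cases h0 : earlyVisits m (SpiderVertex.v L j) s t = 0
  · simp only [h0, if_true]
    by_cases hm : excursionCount s (t + 1) ≤ m
    · have hm' : excursionCount s t ≤ m := (excursionCount_mono s t.le_succ).trans hm
      simp only [hm, if_true]
      rw [spiderMean_const_mul]
      by_cases hs : s t = .body
      · have hE : excursionCount s (t + 1) = excursionCount s t + 1 := by
          rw [excursionCount_succ, if_pos hs]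
        rw [missProb_of_body h0 hm' hs, hs, spiderMean_legMiss_body hN hL, ← pow_succ]
        congr 1
        omega
      · have hE : excursionCount s (t + 1) = excursionCount s t := by
          rw [excursionCount_succ, if_neg hs, add_zero]
        rw [spiderMean_legMiss_of_ne hL hs (ne_v_of_earlyVisits_eq_zero h0 hm')]
        simp [missProb, h0, hm', hE]
    · simp only [hm, if_false]
      rw [spiderMean_const hN]
      by_cases hm' : excursionCount s t ≤ m
      · have hs : s t = .body := by
          by_contra hs
          rw [excursionCount_succ, if_neg hs] at hm
          exact hm hm'
        rw [excursionCount_succ, if_pos hs] at hm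
        rw [missProb_of_body h0 hm' hs, show m - excursionCount s t = 0 by omega, pow_zero]
      · simp [missProb, h0, hm']
  · simp only [h0, if_false]
    rw [spiderMean_const hN]
    simp [missProb, h0]

/-- A single excursion can hit only one of two legs, which makes the two misses negatively
correlated. -/
theorem missProb_mul_supermartingale (hN : N ≠ 0) {L : ℕ} (hL : 1 ≤ L) (m : ℕ) {i j : Fin N}
    (hij : i ≠ j) (t : ℕ) (s : ℕ → SpiderVertex N) :
    spiderMean (fun y => missProb L m i (t + 1) (Function.update s (t + 1) y) *
      missProb L m j (t + 1) (Function.update s (t + 1) y)) (s t) ≤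
      missProb L m i t s * missProb L m j t s := by
  have hmart := missProb_martingale hN hL m j t s
  simp only [missProb_update hL] at hmart ⊢
  by_cases h0i : earlyVisits m (SpiderVertex.v L i) s t = 0
  swap
  · simp [h0i, spiderMean_const hN, missProb]
  by_cases h0j : earlyVisits m (SpiderVertex.v L j) s t = 0
  swap
  · simp [h0j, spiderMean_const hN, missProb]
  simp only [h0i, h0j, if_true] at hmart ⊢
  by_cases hm : excursionCount s (t + 1) ≤ m
  · have hm' : excursionCount s t ≤ m := (excursionCount_mono s t.le_succ).trans hm
    simp only [hm, if_true]
    set β : ℝ := 1 - 1 / ((N : ℝ) * L) with hβ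
    have hprod : (fun y => β ^ (m - excursionCount s (t + 1)) * legMiss L i y *
        (β ^ (m - excursionCount s (t + 1)) * legMiss L j y)) = fun y =>
        (β ^ (m - excursionCount s (t + 1))) ^ 2 * (legMiss L i y + (legMiss L j y + -1)) := by
      ext y
      have := legMiss_mul (L := L) hij y
      linear_combination (β ^ (m - excursionCount s (t + 1))) ^ 2 * this
    rw [hprod, spiderMean_const_mul, spiderMean_add, spiderMean_add, spiderMean_const hN]
    by_cases hs : s t = .body
    · have hE : excursionCount s (t + 1) = excursionCount s t + 1 := by
        rw [excursionCount_succ, if_pos hs]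
      rw [missProb_of_body h0i hm' hs, missProb_of_body h0j hm' hs, hs,
        spiderMean_legMiss_body hN hL, spiderMean_legMiss_body hN hL, ← hβ,
        show m - excursionCount s t = m - excursionCount s (t + 1) + 1 by omega, pow_succ β]
      -- The loss at the body is `2 β - 1 ≤ β ^ 2`: the chance of missing both legs against that for
      -- independent misses.
      nlinarith [sq_nonneg (β ^ (m - excursionCount s (t + 1)) * (β - 1))]
    · have hE : excursionCount s (t + 1) = excursionCount s t := by
        rw [excursionCount_succ, if_neg hs, add_zero]
      rw [spiderMean_legMiss_of_ne hL hs (ne_v_of_earlyVisits_eq_zero h0i hm'),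
        spiderMean_legMiss_of_ne hL hs (ne_v_of_earlyVisits_eq_zero h0j hm')]
      have := legMiss_mul (L := L) hij (s t)
      simp only [missProb, h0i, h0j, hm', hE, if_true, ← hβ]
      refine le_of_eq ?_
      linear_combination -(β ^ (m - excursionCount s t)) ^ 2 * this
  · have hi := missProb_martingale hN hL m i t s
    simp only [missProb_update hL] at hi
    simp only [h0i, hm, if_true, if_false] at hi hmart ⊢
    rw [spiderMean_const hN] at hi hmart
    rw [← hi, ← hmart, spiderMean_const hN]

/-- It is unlikely that all legs are visited at height `L` during few excursions. -/
theorem spiderExp_all_visited_le (hN : N ≠ 0) {L : ℕ} (hL : 1 ≤ L) (m n : ℕ)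
    (hβ : 0 < 1 - 1 / ((N : ℝ) * L)) :
    spiderExp (Set.indicator {s : ℕ → SpiderVertex N | excursionCount s n ≤ m ∧
      ∀ j, 1 ≤ spiderLocalTime s (SpiderVertex.v L j) n} 1) n 0 (fun _ => .body) ≤
      1 / (N * (1 - 1 / ((N : ℝ) * L)) ^ m) := by
  set β : ℝ := 1 - 1 / ((N : ℝ) * L) with hβdef
  have hN' : (0 : ℝ) < N := by exact_mod_cast Nat.pos_of_ne_zero hN
  set a : ℝ := N * β ^ m with ha
  have ha0 : 0 < a := by positivity
  have hstart : ∀ j : Fin N, missProb L m j 0 (fun _ => .body) = β ^ m := by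
    intro j
    obtain ⟨l, rfl⟩ : ∃ l, L = l + 1 := ⟨L - 1, by omega⟩
    rw [missProb_of_body (by simp [earlyVisits, SpiderVertex.v]) (by simp [excursionCount]) rfl]
    simp [excursionCount, hβdef]
  have hone : ∀ j : Fin N, spiderExp (missProb L m j n) n 0 (fun _ => .body) = β ^ m := by
    intro j
    have := spiderExp_eq_of_martingale (missProb_martingale hN hL m j) n 0 fun _ => .body
    rwa [zero_add, hstart] at this
  have htwo : ∀ i j : Fin N, spiderExp (fun s => missProb L m i n s * missProb L m j n s) n 0
      (fun _ => .body) ≤ β ^ m * β ^ m + if i = j then β ^ m else 0 := by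
    intro i j
    by_cases hij : i = j
    · subst hij
      rw [if_pos rfl]
      refine (spiderExp_mono (G := missProb L m i n) (fun s => ?_) n 0 _).trans ?_
      · have := missProb_mem_Icc hL m i n s
        exact mul_le_of_le_one_right this.1 this.2
      · rw [hone]
        have : 0 ≤ β ^ m * β ^ m := by positivity
        linarith
    · rw [if_neg hij, add_zero]
      have := spiderExp_le_of_supermartingale
        (f := fun t s => missProb L m i t s * missProb L m j t s)
        (missProb_mul_supermartingale hN hL m hij) n 0 fun _ => .body
      rwa [zero_add, hstart, hstart] at this
  -- Chebyshev: on the event every `missProb` vanishes, so their sum is at distance `a` from its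
  -- mean `a`. The first `m` excursions need not be over at time `n`.
  have hdom : ∀ s : ℕ → SpiderVertex N, Set.indicator {s : ℕ → SpiderVertex N |
      excursionCount s n ≤ m ∧ ∀ j, 1 ≤ spiderLocalTime s (SpiderVertex.v L j) n} 1 s ≤
      (a ^ 2)⁻¹ * ((∑ i, ∑ j, missProb L m i n s * missProb L m j n s) +
        ((-2 * a) * ∑ j, missProb L m j n s + a ^ 2)) := by
    intro s
    have hsq : (∑ i, ∑ j, missProb L m i n s * missProb L m j n s) +
        ((-2 * a) * ∑ j, missProb L m j n s + a ^ 2) = (∑ j, missProb L m j n s - a) ^ 2 := by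
      rw [← Finset.sum_mul_sum]
      ring
    rw [hsq]
    by_cases hs : excursionCount s n ≤ m ∧ ∀ j, 1 ≤ spiderLocalTime s (SpiderVertex.v L j) n
    · have hz : ∀ j, missProb L m j n s = 0 := by
        intro j
        have := hs.2 j
        rw [← earlyVisits_eq_spiderLocalTime hs.1] at this
        rw [missProb, if_neg (by omega)]
      rw [Set.indicator_of_mem (by exact hs)]
      simp only [hz, Finset.sum_const_zero, Pi.one_apply]
      refine le_of_eq ?_
      field_simp
      ring
    · rw [Set.indicator_of_notMem (by exact hs)]
      positivity
  refine (spiderExp_mono hdom n 0 _).trans ?_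
  rw [spiderExp_const_mul, spiderExp_add, spiderExp_add, spiderExp_const_mul, spiderExp_const hN,
    spiderExp_sum, spiderExp_sum]
  simp only [spiderExp_sum, hone]
  have hbound : ∑ i : Fin N, ∑ j : Fin N, spiderExp
      (fun s => missProb L m i n s * missProb L m j n s) n 0 (fun _ => .body) ≤ a ^ 2 + a := by
    refine (Finset.sum_le_sum fun i _ => Finset.sum_le_sum fun j _ => htwo i j).trans ?_
    refine le_of_eq ?_
    simp only [Finset.sum_add_distrib, Finset.sum_ite_eq, Finset.mem_univ, if_true,
      Finset.sum_const, Finset.card_univ, Fintype.card_fin, nsmul_eq_mul, ha]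
    ring
  have hsum : ∑ _i : Fin N, β ^ m = a := by simp [ha]
  rw [hsum, inv_mul_le_iff₀ (by positivity), mul_one_div]
  have : a ^ 2 / a = a := by field_simp
  rw [this]
  nlinarith

end Missed

/-! ### The simple random walk and its reflection formula. -/

section SimpleWalk

/-- The law at time `n` of the simple symmetric random walk on the line. -/
noncomputable def srwLaw : ℕ → Measure ℝ
  | 0 => Measure.dirac 0
  | n + 1 => (2⁻¹ : ENNReal) • ((srwLaw n).map (· + 1) + (srwLaw n).map (· + -1))

instance srwLaw.instIsProbabilityMeasure (n : ℕ) : IsProbabilityMeasure (srwLaw n) := by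
  induction n with
  | zero => unfold srwLaw; infer_instance
  | succ n ih =>
    refine ⟨?_⟩
    rw [srwLaw, Measure.smul_apply, Measure.add_apply,
      Measure.map_apply (by fun_prop) MeasurableSet.univ,
      Measure.map_apply (by fun_prop) MeasurableSet.univ, Set.preimage_univ, Set.preimage_univ,
      measure_univ, smul_eq_mul, one_add_one_eq_two,
      ENNReal.inv_mul_cancel two_ne_zero ENNReal.ofNat_ne_top]

theorem srwLaw_real_succ (n : ℕ) {A : Set ℝ} (hA : MeasurableSet A) :
    (srwLaw (n + 1)).real A =
      ((srwLaw n).real ((· + 1) ⁻¹' A) + (srwLaw n).real ((· + -1) ⁻¹' A)) / 2 := by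
  have h1 : Measurable fun x : ℝ => x + 1 := by fun_prop
  have h2 : Measurable fun x : ℝ => x + -1 := by fun_prop
  rw [srwLaw, measureReal_ennreal_smul_apply, measureReal_add_apply,
    map_measureReal_apply h1 hA, map_measureReal_apply h2 hA]
  simp
  ring

theorem srwLaw_real_Ici_succ (n : ℕ) (a : ℝ) :
    (srwLaw (n + 1)).real (Set.Ici a) =
      ((srwLaw n).real (Set.Ici (a - 1)) + (srwLaw n).real (Set.Ici (a + 1))) / 2 := by
  rw [srwLaw_real_succ n measurableSet_Ici, Set.preimage_add_const_Ici,
    Set.preimage_add_const_Ici, sub_neg_eq_add]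

theorem srwLaw_real_Ioi_succ (n : ℕ) (a : ℝ) :
    (srwLaw (n + 1)).real (Set.Ioi a) =
      ((srwLaw n).real (Set.Ioi (a - 1)) + (srwLaw n).real (Set.Ioi (a + 1))) / 2 := by
  rw [srwLaw_real_succ n measurableSet_Ioi, Set.preimage_add_const_Ioi,
    Set.preimage_add_const_Ioi, sub_neg_eq_add]

theorem srwLaw_real_Iio_neg (n : ℕ) :
    ∀ a, (srwLaw n).real (Set.Iio (-a)) = (srwLaw n).real (Set.Ioi a) := by
  induction n with
  | zero => intro a; simp [srwLaw, measureReal_def, Set.indicator]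
  | succ n ih =>
    intro a
    rw [srwLaw_real_Ioi_succ, srwLaw_real_succ n measurableSet_Iio, Set.preimage_add_const_Iio,
      Set.preimage_add_const_Iio, ← ih, ← ih, add_comm]
    congr 5 <;> ring

/-- The probability that the maximum of the simple random walk up to time `n` is at least `a`,
expressed by the reflection principle. -/
noncomputable def srwMaxTail (n : ℕ) (a : ℝ) : ℝ :=
  (srwLaw n).real (Set.Ici a) + (srwLaw n).real (Set.Ioi a)

/-- This recursion, the value `1` at level `0` and the value `0` at time `0` for positive levels are
all that is used to identify the excursion law; the maximum itself is never formed. -/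
theorem srwMaxTail_succ (n : ℕ) (a : ℝ) :
    srwMaxTail (n + 1) a = (srwMaxTail n (a + 1) + srwMaxTail n (a - 1)) / 2 := by
  rw [srwMaxTail, srwLaw_real_Ici_succ, srwLaw_real_Ioi_succ, srwMaxTail, srwMaxTail]
  ring

/-- By symmetry the mass of the open positive half-line equals that of the negative one, which is
the complement of `[0, ∞)`. -/
theorem srwMaxTail_zero_right (n : ℕ) : srwMaxTail n 0 = 1 := by
  rw [srwMaxTail, ← srwLaw_real_Iio_neg, neg_zero, ← Set.compl_Ici,
    probReal_compl_eq_one_sub measurableSet_Ici]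
  ring

theorem srwMaxTail_zero_left {a : ℝ} (ha : 0 < a) : srwMaxTail 0 a = 0 := by
  simp [srwMaxTail, srwLaw, measureReal_def, Set.indicator, ha.not_ge, ha.not_gt]

theorem charFun_srwLaw (n : ℕ) (t : ℝ) : charFun (srwLaw n) t = ((Real.cos t ^ n : ℝ) : ℂ) := by
  induction n with
  | zero => simp [srwLaw]
  | succ n ih =>
    have hint : ∀ ν : Measure ℝ, IsProbabilityMeasure ν →
        Integrable (fun x : ℝ => Complex.exp (t * x * Complex.I)) ν := by
      intro ν _
      refine Integrable.of_bound (by fun_prop) 1 (ae_of_all _ fun x => ?_)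
      rw [← Complex.ofReal_mul, Complex.norm_exp_ofReal_mul_I]
    have h1 : IsProbabilityMeasure ((srwLaw n).map (· + (1 : ℝ))) :=
      Measure.isProbabilityMeasure_map (by fun_prop)
    have h2 : IsProbabilityMeasure ((srwLaw n).map (· + (-1 : ℝ))) :=
      Measure.isProbabilityMeasure_map (by fun_prop)
    rw [charFun_apply_real, srwLaw, integral_smul_measure,
      integral_add_measure (hint _ h1) (hint _ h2), ← charFun_apply_real, ← charFun_apply_real,
      charFun_map_add_const, charFun_map_add_const, ih]
    have hc : Complex.exp (t * Complex.I) + Complex.exp (-(t * Complex.I)) =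
        2 * Complex.cos t := by
      rw [Complex.two_cos, neg_mul]
    simp
    linear_combination (1 / 2 : ℂ) * (Complex.cos t) ^ n * hc

end SimpleWalk

/-! ### The central limit theorem via characteristic functions. -/

section Asymptotics

theorem tendsto_one_add_pow_of_tendsto_mul {k : ℕ → ℕ} {x : ℕ → ℝ} {c : ℝ}
    (hx : Tendsto x atTop (𝓝 0)) (hkx : Tendsto (fun n => (k n : ℝ) * x n) atTop (𝓝 c)) :
    Tendsto (fun n => (1 + x n) ^ k n) atTop (𝓝 (Real.exp c)) := by
  have hlog : Tendsto (fun n => (k n : ℝ) * Real.log (1 + x n)) atTop (𝓝 c) := by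
    have hd : (fun h : ℝ => Real.log (1 + h) - h) =o[𝓝 0] fun h => h := by
      have := (hasDerivAt_iff_isLittleO_nhds_zero).1 (Real.hasDerivAt_log one_ne_zero)
      simpa using this
    have h1 : (fun n => (k n : ℝ) * (Real.log (1 + x n) - x n)) =o[atTop]
        fun n => (k n : ℝ) * x n :=
      (Asymptotics.isBigO_refl _ _).mul_isLittleO (hd.comp_tendsto hx)
    have h2 := h1.trans_isBigO (hkx.isBigO_one ℝ)
    have h3 := ((Asymptotics.isLittleO_one_iff ℝ).1 h2).add hkx
    rw [zero_add] at h3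
    refine h3.congr fun n => ?_
    ring
  refine ((Real.continuous_exp.tendsto _).comp hlog).congr' ?_
  have hpos : ∀ᶠ n in atTop, -1 < x n := hx.eventually (lt_mem_nhds (by norm_num))
  filter_upwards [hpos] with n hn
  rw [Function.comp_apply, mul_comm, Real.exp_mul, Real.exp_log (by linarith), Real.rpow_natCast]

theorem tendsto_cos_pow {k : ℕ → ℕ} {u : ℕ → ℝ} {c : ℝ}
    (hu : Tendsto u atTop (𝓝 0)) (hku : Tendsto (fun n => (k n : ℝ) * u n ^ 2) atTop (𝓝 c)) :
    Tendsto (fun n => Real.cos (u n) ^ k n) atTop (𝓝 (Real.exp (-c / 2))) := by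
  have hx : Tendsto (fun n => Real.cos (u n) - 1) atTop (𝓝 0) := by
    have := (Real.continuous_cos.tendsto 0).comp hu
    simpa using this.sub_const 1
  have herr : Tendsto (fun n => (k n : ℝ) * (Real.cos (u n) - (1 - u n ^ 2 / 2))) atTop (𝓝 0) := by
    have hb : Tendsto (fun n => ((k n : ℝ) * u n ^ 2) * u n ^ 2 * (5 / 96)) atTop (𝓝 0) := by
      have := (hku.mul (hu.pow 2)).mul_const (5 / 96)
      simpa using this
    refine squeeze_zero_norm' ?_ hb
    have hsmall : ∀ᶠ n in atTop, |u n| < 1 := by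
      have := hu.abs
      rw [abs_zero] at this
      exact this.eventually (gt_mem_nhds one_pos)
    filter_upwards [hsmall] with n hn
    rw [Real.norm_eq_abs, abs_mul, Nat.abs_cast]
    have := mul_le_mul_of_nonneg_left (Real.cos_bound hn.le) (Nat.cast_nonneg (α := ℝ) (k n))
    refine this.trans (le_of_eq ?_)
    rw [show |u n| ^ 4 = (|u n| ^ 2) ^ 2 by ring, sq_abs]
    ring
  have hkx : Tendsto (fun n => (k n : ℝ) * (Real.cos (u n) - 1)) atTop (𝓝 (-c / 2)) := by
    have := herr.sub (hku.div_const 2)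
    rw [zero_sub, ← neg_div] at this
    refine this.congr fun n => ?_
    ring
  simpa using tendsto_one_add_pow_of_tendsto_mul hx hkx

theorem gaussianReal_real_lt_abs {y : ℝ} (hy : 0 ≤ y) :
    (gaussianReal 0 1).real {z | y < |z|} =
      (gaussianReal 0 1).real (Set.Ici y) + (gaussianReal 0 1).real (Set.Ioi y) := by
  have hna := nullSingletonClass_gaussianReal (μ := 0) (v := 1) one_ne_zero
  have hset : {z : ℝ | y < |z|} = Set.Ioi y ∪ Set.Iio (-y) := by
    ext z
    simp [lt_abs, lt_neg]
  have hsymm : (gaussianReal 0 1).real (Set.Iio (-y)) = (gaussianReal 0 1).real (Set.Ioi y) := by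
    have h := gaussianReal_map_neg (μ := 0) (v := 1)
    rw [neg_zero] at h
    conv_lhs => rw [← h]
    rw [map_measureReal_apply measurable_neg measurableSet_Iio]
    congr 1
    ext z
    simp
  rw [hset, measureReal_union ?_ measurableSet_Iio, hsymm, measureReal_congr Ioi_ae_eq_Ici]
  refine Set.disjoint_left.2 fun z h1 h2 => ?_
  simp only [Set.mem_Ioi, Set.mem_Iio] at h1 h2
  linarith

/-- The central limit theorem for the maximum of the simple random walk. -/
theorem tendsto_srwMaxTail {k a : ℕ → ℕ} {y : ℝ} (hy : 0 < y) (ha : Tendsto a atTop atTop)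
    (hka : Tendsto (fun n => (k n : ℝ) / (a n : ℝ) ^ 2) atTop (𝓝 (1 / y ^ 2))) :
    Tendsto (fun n => srwMaxTail (k n) (a n)) atTop
      (𝓝 ((gaussianReal 0 1).real {z | y < |z|})) := by
  have hna := nullSingletonClass_gaussianReal (μ := 0) (v := 1) one_ne_zero
  have haR : Tendsto (fun n => (a n : ℝ)) atTop atTop := tendsto_natCast_atTop_atTop.comp ha
  -- Scaling by `y / a n` sends level `a n` to the fixed level `y` and brings the variance `k n * (y
  -- / a n) ^ 2` to `1`.
  let M : ℕ → ProbabilityMeasure ℝ := fun n =>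
    ⟨(srwLaw (k n)).map ((y / a n) * ·), Measure.isProbabilityMeasure_map (by fun_prop)⟩
  have hM : Tendsto M atTop (𝓝 ⟨gaussianReal 0 1, inferInstance⟩) := by
    refine ProbabilityMeasure.tendsto_iff_tendsto_charFun.2 fun t => ?_
    simp only [M, ProbabilityMeasure.coe_mk, charFun_map_mul, charFun_srwLaw]
    have hu : Tendsto (fun n => y / a n * t) atTop (𝓝 0) := by
      simpa using (haR.const_div_atTop y).mul_const t
    have hku : Tendsto (fun n => (k n : ℝ) * (y / a n * t) ^ 2) atTop (𝓝 (t ^ 2)) := by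
      have := hka.mul_const (y ^ 2 * t ^ 2)
      rw [show 1 / y ^ 2 * (y ^ 2 * t ^ 2) = t ^ 2 by field_simp] at this
      refine this.congr fun n => ?_
      ring
    have := (Complex.continuous_ofReal.tendsto _).comp (tendsto_cos_pow hu hku)
    rw [charFun_gaussianReal]
    convert! this using 2
    push_cast
    simp [neg_div]
  have hlim : ∀ E : Set ℝ, gaussianReal 0 1 (frontier E) = 0 →
      Tendsto (fun n => ((srwLaw (k n)).map ((y / a n) * ·)).real E) atTop
        (𝓝 ((gaussianReal 0 1).real E)) := by
    intro E hE
    have := ProbabilityMeasure.tendsto_measure_of_null_frontier_of_tendsto' hM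
      (E := E) (by simpa using hE)
    exact (ENNReal.tendsto_toReal (measure_ne_top _ _)).comp this
  rw [gaussianReal_real_lt_abs hy.le]
  refine ((hlim (Set.Ici y) (by simp)).add (hlim (Set.Ioi y) (by simp))).congr' ?_
  filter_upwards [ha.eventually_gt_atTop 0] with n hn
  have hn' : (0 : ℝ) < a n := by exact_mod_cast hn
  have hm : Measurable fun x : ℝ => y / a n * x := by fun_prop
  rw [srwMaxTail, map_measureReal_apply hm measurableSet_Ici,
    map_measureReal_apply hm measurableSet_Ioi]
  congr 2
  · ext x
    simp only [Set.mem_preimage, Set.mem_Ici]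
    rw [div_mul_eq_mul_div, le_div_iff₀ hn', mul_le_mul_iff_right₀ hy]
  · ext x
    simp only [Set.mem_preimage, Set.mem_Ioi]
    rw [div_mul_eq_mul_div, lt_div_iff₀ hn', mul_lt_mul_iff_right₀ hy]

end Asymptotics

/-! ### The exact law of the number of excursions. -/

section ExcursionLaw

variable {N : ℕ}

/-- The height of a vertex above the body. -/
def SpiderVertex.height : SpiderVertex N → ℕ
  | .body => 0
  | .leg r _ => r + 1

theorem SpiderVertex.height_v (r : ℕ) (j : Fin N) : (v r j).height = r := by
  cases r <;> rfl

/-- The probability of `q` more visits to the body before time `d`, from height `h`. -/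
noncomputable def excursionTail (d h : ℕ) : ℕ → ℝ
  | 0 => 1
  | q + 1 => if q + 1 ≤ d then srwMaxTail (d - (q + 1)) (h + q) else 0

/-- Being at the body uses up one visit, and the next step leads to height `1` with certainty. -/
theorem excursionTail_zero_succ (d q : ℕ) :
    excursionTail (d + 1) 0 (q + 1) = excursionTail d 1 q := by
  cases q with
  | zero => simp [excursionTail, srwMaxTail_zero_right]
  | succ q =>
    by_cases h : q + 1 ≤ d
    · simp [excursionTail, h, show d + 1 - (q + 1 + 1) = d - (q + 1) by omega]
      ring_nf
    · simp [excursionTail, h]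

theorem excursionTail_succ (d h q : ℕ) :
    excursionTail (d + 1) (h + 1) q =
      (excursionTail d (h + 2) q + excursionTail d h q) / 2 := by
  cases q with
  | zero => simp [excursionTail]
  | succ q =>
    by_cases hd : q + 1 ≤ d
    · simp only [excursionTail, hd, show q + 1 ≤ d + 1 by omega, if_true,
        show d + 1 - (q + 1) = d - (q + 1) + 1 by omega, srwMaxTail_succ]
      push_cast
      ring_nf
    -- Boundary case: with `d + 1` steps left the simple walk has no time to move, and its target
    -- level is positive.
    · by_cases hd' : q = d
      · subst hd'
        have : (0 : ℝ) < ((h + 1 : ℕ) : ℝ) + q := by positivity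
        simp only [excursionTail, hd, le_refl, if_true, if_false, Nat.sub_self,
          srwMaxTail_zero_left this]
        norm_num
      · simp only [excursionTail, hd, show ¬ q + 1 ≤ d + 1 by omega, if_false]
        norm_num

/-- From height `h`, the visit number `q + 1` requires a total descent of `h + q` and `q` forced
steps up, so it occurs before time `d` exactly when the descent takes at most `d - (q + 1)` free
steps. The proof checks the resulting formula by backward induction. -/
theorem spiderExp_excursionCount (hN : N ≠ 0) (q n d : ℕ) :
    ∀ t, t + d = n → ∀ s : ℕ → SpiderVertex N,
      spiderExp (Set.indicator {s | q ≤ excursionCount s n} 1) d t s =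
        excursionTail d (s t).height (q - excursionCount s t) := by
  induction d with
  | zero =>
    intro t ht s
    obtain rfl : t = n := by omega
    by_cases h : q ≤ excursionCount s t
    · simp [spiderExp, h, Nat.sub_eq_zero_of_le h, excursionTail]
    · obtain ⟨r, hr⟩ : ∃ r, q - excursionCount s t = r + 1 :=
        ⟨q - excursionCount s t - 1, by omega⟩
      simp [spiderExp, h, hr, excursionTail]
  | succ d ih =>
    intro t ht s
    have hfun : (fun y => spiderExp (Set.indicator {s | q ≤ excursionCount s n} 1) d (t + 1)
        (Function.update s (t + 1) y)) =
        fun y => excursionTail d y.height (q - excursionCount s (t + 1)) := by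
      ext y
      rw [ih (t + 1) (by omega), Function.update_self, excursionCount_update,
        ← excursionCount_succ]
    rw [spiderExp, hfun, excursionCount_succ]
    cases hs : s t with
    | body =>
      have h1 := spiderMean_const hN
        (excursionTail d 1 (q - (excursionCount s t + 1))) SpiderVertex.body
      have h2 : excursionTail (d + 1) 0 (q - excursionCount s t) =
          excursionTail d 1 (q - (excursionCount s t + 1)) := by
        rcases Nat.eq_zero_or_pos (q - excursionCount s t) with h | h
        · rw [h, show q - (excursionCount s t + 1) = 0 by omega]
          rfl
        · rw [← excursionTail_zero_succ]
          congr 1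
          omega
      rw [if_pos rfl]
      exact h1.trans h2.symm
    | leg r j =>
      simp only [spiderMean, SpiderVertex.height_v, reduceCtorEq, if_false, add_zero]
      exact (excursionTail_succ _ _ _).symm

/-- The law of the number of excursions of the spider walk. -/
theorem spiderExp_excursionCount_start (hN : N ≠ 0) {m n : ℕ} (hmn : m + 1 ≤ n) :
    spiderExp (Set.indicator {s : ℕ → SpiderVertex N | m + 1 ≤ excursionCount s n} 1) n 0
      (fun _ => .body) = srwMaxTail (n - (m + 1)) m := by
  rw [spiderExp_excursionCount hN (m + 1) n n 0 (by omega)]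
  simp [excursionCount, excursionTail, hmn, SpiderVertex.height]

end ExcursionLaw

/-! ### Two-sided bounds at a fixed number of legs. -/

section Bounds

variable {N : ℕ} {Ω : Type*} [MeasurableSpace Ω] {μ : Measure Ω} [IsProbabilityMeasure μ]
  {S : ℕ → Ω → SpiderVertex N}

theorem pathDeterminedBy_visits (n L k : ℕ) :
    PathDeterminedBy n {s : ℕ → SpiderVertex N |
      ∀ j, k ≤ spiderLocalTime s (SpiderVertex.v L j) n} := by
  intro s s' h
  simp only [Set.mem_ofPred_eq, spiderLocalTime_congr h]

/-- If the event occurs, either more than `m` excursions have started or at most `m` have covered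
all legs. -/
theorem measureReal_spiderVisitEvent_le (hN : N ≠ 0)
    (hS : IsSpiderWalk (fun _ : Fin N => 1 / (N : ℝ)) μ S) {L k m n : ℕ} (hL : 1 ≤ L)
    (hk : 1 ≤ k) (hmn : m + 1 ≤ n) (hβ : 0 < 1 - 1 / ((N : ℝ) * L)) :
    μ.real (spiderVisitEvent S n L k) ≤
      srwMaxTail (n - (m + 1)) m + 1 / (N * (1 - 1 / ((N : ℝ) * L)) ^ m) := by
  refine (hS.measureReal_eq_spiderExp hN (pathDeterminedBy_visits n L k)).le.trans ?_
  rw [← spiderExp_excursionCount_start hN hmn]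
  refine le_trans ?_ (add_le_add_right (spiderExp_all_visited_le hN hL m n hβ) _)
  rw [← spiderExp_add]
  refine spiderExp_mono (fun s => ?_) n 0 _
  by_cases h : ∀ j, k ≤ spiderLocalTime s (SpiderVertex.v L j) n
  · have h' : ∀ j, 1 ≤ spiderLocalTime s (SpiderVertex.v L j) n := fun j => hk.trans (h j)
    by_cases hm : m + 1 ≤ excursionCount s n
    · simp [Set.indicator, h, show m < excursionCount s n by omega,
        show ¬ excursionCount s n ≤ m by omega]
    · simp [Set.indicator, h, show excursionCount s n ≤ m by omega,
        show ¬ m < excursionCount s n by omega, h']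
  · rw [Set.indicator_of_notMem (by exact h)]
    exact add_nonneg (Set.indicator_nonneg (fun _ _ => zero_le_one) _)
      (Set.indicator_nonneg (fun _ _ => zero_le_one) _)

/-- If `m + 1` excursions have started and the event fails, some leg has fewer than `k` visits; a
union bound over the legs costs the factor `N`. -/
theorem le_measureReal_spiderVisitEvent (hN : N ≠ 0)
    (hS : IsSpiderWalk (fun _ : Fin N => 1 / (N : ℝ)) μ S) {L m n : ℕ} (k : ℕ) (hL : 1 ≤ L)
    (hmn : m + 1 ≤ n) {θ : ℝ} (h0 : 0 < θ) (h1 : θ ≤ 1) :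
    srwMaxTail (n - (m + 1)) m -
        N * ((θ ^ (k + 1))⁻¹ * (1 - (1 - θ) / (N * L)) ^ m) ≤
      μ.real (spiderVisitEvent S n L k) := by
  refine le_trans ?_ (hS.measureReal_eq_spiderExp hN (pathDeterminedBy_visits n L k)).ge
  rw [← spiderExp_excursionCount_start hN hmn, sub_le_iff_le_add]
  have hsum : ∑ j : Fin N, spiderExp (Set.indicator {s | m ≤ excursionCount s n ∧
      spiderLocalTime s (SpiderVertex.v L j) n < k} 1) n 0 (fun _ => .body) ≤
      N * ((θ ^ (k + 1))⁻¹ * (1 - (1 - θ) / (N * L)) ^ m) := by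
    refine (Finset.sum_le_sum fun j _ => spiderExp_few_visits_le hN hL h0 h1 j k m n).trans ?_
    simp
  refine le_trans ?_ (add_le_add_right hsum _)
  rw [← spiderExp_sum, ← spiderExp_add]
  refine spiderExp_mono (fun s => ?_) n 0 _
  have hnn : ∀ j : Fin N, 0 ≤ Set.indicator {s | m ≤ excursionCount s n ∧
      spiderLocalTime s (SpiderVertex.v L j) n < k} (1 : (ℕ → SpiderVertex N) → ℝ) s :=
    fun j => Set.indicator_nonneg (fun _ _ => zero_le_one) _
  by_cases hm : m + 1 ≤ excursionCount s n
  · rw [Set.indicator_of_mem (by exact hm)]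
    by_cases h : ∀ j, k ≤ spiderLocalTime s (SpiderVertex.v L j) n
    · rw [Set.indicator_of_mem (by exact h)]
      have := Finset.sum_nonneg fun j (_ : j ∈ Finset.univ) => hnn j
      simpa using this
    · rw [Set.indicator_of_notMem (by exact h), zero_add]
      push Not at h
      obtain ⟨j, hj⟩ := h
      refine le_trans (le_of_eq ?_)
        (Finset.single_le_sum (fun j _ => hnn j) (Finset.mem_univ j))
      rw [Set.indicator_of_mem]
      exact ⟨by omega, hj⟩
  · rw [Set.indicator_of_notMem (by exact hm)]
    exact add_nonneg (Set.indicator_nonneg (fun _ _ => zero_le_one) _)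
      (Finset.sum_nonneg fun j _ => hnn j)

end Bounds

/-! ### Asymptotics at the cover scale. -/

section Limit

theorem continuousAt_gaussianReal_real_lt_abs (y : ℝ) :
    ContinuousAt (fun y : ℝ => (gaussianReal 0 1).real {z : ℝ | y < |z|}) y := by
  have hna := nullSingletonClass_gaussianReal (μ := 0) (v := 1) one_ne_zero
  have hmeas : ∀ y : ℝ, MeasurableSet {z : ℝ | y < |z|} := fun y =>
    measurableSet_lt measurable_const (by fun_prop)
  refine (ENNReal.tendsto_toReal (measure_ne_top _ _)).comp ?_
  -- The indicators converge except at `z = y` and `z = -y`, which the normal law does not charge.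
  refine tendsto_measure_of_ae_tendsto_indicator_of_isFiniteMeasure _ (hmeas y) hmeas ?_
  have hae : ∀ᵐ z ∂(gaussianReal 0 1), z ∉ ({y, -y} : Set ℝ) :=
    measure_eq_zero_iff_ae_notMem.1 ((Set.toFinite _).measure_zero _)
  filter_upwards [hae] with z hz
  have hzy : |z| ≠ y := by
    intro h
    rcases abs_choice z with h' | h' <;> refine hz ?_
    · simp [← h, h']
    · simp [← h, h']
  rcases hzy.lt_or_gt with h | h
  · filter_upwards [lt_mem_nhds h] with w hw
    exact iff_of_false (not_lt.2 hw.le) (not_lt.2 h.le)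
  · filter_upwards [gt_mem_nhds h] with w hw
    exact iff_of_true hw h

variable {L : ℕ → ℕ}

/-- The number of excursions needed to visit all legs at height `L`, to first order. -/
noncomputable def coverScale (L : ℕ → ℕ) (N : ℕ) : ℝ := N * L N * Real.log N

theorem tendsto_log_natCast : Tendsto (fun N : ℕ => Real.log N) atTop atTop :=
  Real.tendsto_log_atTop.comp tendsto_natCast_atTop_atTop

theorem tendsto_coverScale (hL : ∀ᶠ N in atTop, 1 ≤ L N) :
    Tendsto (coverScale L) atTop atTop := by
  refine tendsto_atTop_mono' atTop ?_ tendsto_log_natCast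
  filter_upwards [hL, eventually_ge_atTop 1] with N h1 h2
  have h1' : (1 : ℝ) ≤ L N := by exact_mod_cast h1
  have h2' : (1 : ℝ) ≤ N := by exact_mod_cast h2
  have := Real.log_nonneg h2'
  rw [coverScale]
  exact le_mul_of_one_le_left this (one_le_mul_of_one_le_of_one_le h2' h1')

theorem floor_scaling {T : ℕ → ℝ} (hT : Tendsto T atTop atTop) {b c : ℝ} (hb : 0 < b)
    (hc : 0 < c) :
    Tendsto (fun N => ⌊b * T N⌋₊) atTop atTop ∧
    (∀ᶠ N in atTop, ⌊b * T N⌋₊ + 1 ≤ ⌊(c * T N) ^ 2⌋₊) ∧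
    Tendsto (fun N => ((⌊(c * T N) ^ 2⌋₊ - (⌊b * T N⌋₊ + 1) : ℕ) : ℝ) / (⌊b * T N⌋₊ : ℝ) ^ 2)
      atTop (𝓝 (1 / (b / c) ^ 2)) := by
  have hm : Tendsto (fun N => (⌊b * T N⌋₊ : ℝ) / T N) atTop (𝓝 b) :=
    (tendsto_nat_floor_mul_div_atTop hb.le).comp hT
  have hT2 : Tendsto (fun N => T N ^ 2) atTop atTop := (tendsto_pow_atTop two_ne_zero).comp hT
  have hn : Tendsto (fun N => (⌊(c * T N) ^ 2⌋₊ : ℝ) / T N ^ 2) atTop (𝓝 (c ^ 2)) := by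
    have := (tendsto_nat_floor_mul_div_atTop (sq_nonneg c)).comp hT2
    simpa [mul_pow, Function.comp_def] using this
  have hinv : Tendsto (fun N => (T N)⁻¹) atTop (𝓝 0) := tendsto_inv_atTop_zero.comp hT
  have hdiff : Tendsto (fun N => ((⌊(c * T N) ^ 2⌋₊ : ℝ) - (⌊b * T N⌋₊ + 1)) / T N ^ 2) atTop
      (𝓝 (c ^ 2)) := by
    have := (hn.sub (hm.mul hinv)).sub (hinv.pow 2)
    simp only [mul_zero, sub_zero, ne_eq, OfNat.ofNat_ne_zero, not_false_eq_true, zero_pow] at this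
    refine this.congr fun N => ?_
    ring
  have hle : ∀ᶠ N in atTop, ⌊b * T N⌋₊ + 1 ≤ ⌊(c * T N) ^ 2⌋₊ := by
    filter_upwards [hdiff.eventually (lt_mem_nhds (by positivity)), hT.eventually_gt_atTop 0]
      with N h1 h2
    rw [lt_div_iff₀ (by positivity), zero_mul, sub_pos] at h1
    exact_mod_cast h1.le
  refine ⟨tendsto_nat_floor_atTop.comp (hT.const_mul_atTop hb), hle, ?_⟩
  have := hdiff.div (hm.pow 2) (by positivity)
  rw [show 1 / (b / c) ^ 2 = c ^ 2 / b ^ 2 by field_simp]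
  refine this.congr' ?_
  filter_upwards [hle, hT.eventually_gt_atTop 0] with N h1 h2
  rw [Nat.cast_sub h1, Pi.div_apply]
  push_cast
  field_simp

theorem tendsto_srwMaxTail_floor {T : ℕ → ℝ} (hT : Tendsto T atTop atTop) {b c : ℝ} (hb : 0 < b)
    (hc : 0 < c) :
    Tendsto (fun N => srwMaxTail (⌊(c * T N) ^ 2⌋₊ - (⌊b * T N⌋₊ + 1)) ⌊b * T N⌋₊) atTop
      (𝓝 ((gaussianReal 0 1).real {z : ℝ | b / c < |z|})) :=
  have h := floor_scaling hT hb hc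
  tendsto_srwMaxTail (by positivity) h.1 h.2.2

theorem tendsto_exp_neg_mul_log {δ : ℝ} (hδ : 0 < δ) :
    Tendsto (fun N : ℕ => Real.exp (-(δ * Real.log N))) atTop (𝓝 0) :=
  Real.tendsto_exp_neg_atTop_nhds_zero.comp (tendsto_log_natCast.const_mul_atTop hδ)

/-- The expression is at most a constant times `N ^ (1 - (1 - θ) b)`; rounding `m` down costs the
factor `exp (1 - θ)`. -/
theorem tendsto_many_excursions (hL : ∀ᶠ N in atTop, 1 ≤ L N) {b θ : ℝ}
    (h0 : 0 < θ) (h1 : θ < 1) (hbθ : 1 < (1 - θ) * b) (C : ℝ) (hC : 0 ≤ C) :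
    Tendsto (fun N : ℕ => N * (C * (1 - (1 - θ) / (N * L N)) ^ ⌊b * coverScale L N⌋₊)) atTop
      (𝓝 0) := by
  have hlim := (tendsto_exp_neg_mul_log (sub_pos.2 hbθ)).const_mul (C * Real.exp (1 - θ))
  rw [mul_zero] at hlim
  refine squeeze_zero' ?_ ?_ hlim
  · filter_upwards [hL, eventually_ge_atTop 1] with N hLN hN
    have hLN' : (1 : ℝ) ≤ L N := by exact_mod_cast hLN
    have hN' : (1 : ℝ) ≤ N := by exact_mod_cast hN
    have h2 : (1 - θ) / (N * L N) ≤ 1 :=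
      (div_le_self (by linarith) (one_le_mul_of_one_le_of_one_le hN' hLN')).trans (by linarith)
    have : 0 ≤ 1 - (1 - θ) / (N * L N) := by linarith
    positivity
  · filter_upwards [hL, eventually_ge_atTop 1] with N hLN hN
    have hLN' : (1 : ℝ) ≤ L N := by exact_mod_cast hLN
    have hN' : (1 : ℝ) ≤ N := by exact_mod_cast hN
    have hNL : 1 ≤ (N : ℝ) * L N := one_le_mul_of_one_le_of_one_le hN' hLN'
    set m := ⌊b * coverScale L N⌋₊
    have hm : b * coverScale L N - 1 ≤ m := (Nat.sub_one_lt_floor _).le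
    have h2 : (1 - θ) / (N * L N) ≤ 1 := (div_le_self (by linarith) hNL).trans (by linarith)
    have hpow : (1 - (1 - θ) / (N * L N)) ^ m ≤
        Real.exp (-((1 - θ) * (b * Real.log N - 1))) := by
      refine (pow_le_pow_left₀ (by linarith) (Real.one_sub_le_exp_neg _) m).trans ?_
      rw [← Real.exp_nat_mul, Real.exp_le_exp, mul_neg, neg_le_neg_iff]
      have h3 : b * Real.log N - 1 ≤ m / (N * L N) := by
        rw [le_div_iff₀ (by positivity)]
        refine le_trans ?_ hm
        rw [coverScale]
        nlinarith
      calc (1 - θ) * (b * Real.log N - 1) ≤ (1 - θ) * (m / (N * L N)) :=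
            mul_le_mul_of_nonneg_left h3 (by linarith)
        _ = _ := by ring
    calc (N : ℝ) * (C * (1 - (1 - θ) / (N * L N)) ^ m)
        ≤ N * (C * Real.exp (-((1 - θ) * (b * Real.log N - 1)))) := by gcongr
      _ = Real.exp (Real.log N) * (C * Real.exp (-((1 - θ) * (b * Real.log N - 1)))) := by
          rw [Real.exp_log (by linarith)]
      _ = C * Real.exp (1 - θ) * Real.exp (-(((1 - θ) * b - 1) * Real.log N)) := by
          rw [mul_left_comm, ← Real.exp_add, mul_assoc, ← Real.exp_add]
          ring_nf

theorem one_sub_inv_pos {N L : ℕ} (hN : 2 ≤ N) (hL : 1 ≤ L) :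
    1 - 1 / (N : ℝ) ≤ 1 - 1 / ((N : ℝ) * L) ∧ 0 < 1 - 1 / ((N : ℝ) * L) := by
  have hL' : (1 : ℝ) ≤ L := by exact_mod_cast hL
  have hN' : (2 : ℝ) ≤ N := by exact_mod_cast hN
  have h1 : 1 / ((N : ℝ) * L) ≤ 1 / N :=
    one_div_le_one_div_of_le (by linarith) (le_mul_of_one_le_right (by linarith) hL')
  have h2 : 1 / (N : ℝ) ≤ 1 / 2 := one_div_le_one_div_of_le two_pos hN'
  constructor <;> linarith

/-- With `β` the base of the power, `log β ≥ 1 - 1 / β` makes the power at least `N ^ (-b / β)`. As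
`β` tends to `1`, the exponent `b / β` is eventually at most `(1 + b) / 2 < 1`. -/
theorem tendsto_few_excursions (hL : ∀ᶠ N in atTop, 1 ≤ L N) {b : ℝ} (hb : 0 < b) (hb1 : b < 1) :
    Tendsto (fun N : ℕ => 1 / (N * (1 - 1 / ((N : ℝ) * L N)) ^ ⌊b * coverScale L N⌋₊)) atTop
      (𝓝 0) := by
  have hlim := tendsto_exp_neg_mul_log (δ := (1 - b) / 2) (by linarith)
  have hinv : Tendsto (fun N : ℕ => 1 - 1 / (N : ℝ)) atTop (𝓝 1) := by
    simpa using tendsto_one_div_atTop_nhds_zero_nat.const_sub (1 : ℝ)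
  -- The threshold `2 b / (1 + b)` is what `b / β ≤ (1 + b) / 2` demands of `β`.
  have hlarge := hinv.eventually (lt_mem_nhds (show 2 * b / (1 + b) < 1 by
    rw [div_lt_one (by linarith)]; linarith))
  refine squeeze_zero' ?_ ?_ hlim
  · filter_upwards [hL, eventually_ge_atTop 2] with N hLN hN
    have := (one_sub_inv_pos hN hLN).2
    positivity
  · filter_upwards [hL, eventually_ge_atTop 2, hlarge] with N hLN hN hlN
    have hLN' : (1 : ℝ) ≤ L N := by exact_mod_cast hLN
    have hN' : (2 : ℝ) ≤ N := by exact_mod_cast hN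
    have hNL : 0 < (N : ℝ) * L N := by positivity
    have hlog : 0 ≤ Real.log N := Real.log_nonneg (by linarith)
    obtain ⟨hβ, hβ0⟩ := one_sub_inv_pos hN hLN
    set m := ⌊b * coverScale L N⌋₊
    have hm : (m : ℝ) ≤ b * coverScale L N :=
      Nat.floor_le (mul_nonneg hb.le (mul_nonneg hNL.le hlog))
    set β : ℝ := 1 - 1 / ((N : ℝ) * L N) with hβdef
    have hbβ : b / β ≤ (1 + b) / 2 := by
      rw [div_le_iff₀ hβ0]
      have := hlN.le.trans hβ
      rw [div_le_iff₀ (by linarith)] at this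
      linarith
    have hpow : Real.exp (-((1 + b) / 2 * Real.log N)) ≤ β ^ m := by
      rw [← Real.exp_log (pow_pos hβ0 m), Real.exp_le_exp, Real.log_pow]
      have h1 := Real.one_sub_inv_le_log_of_pos hβ0
      have h2 : 1 - β⁻¹ = -(1 / (N * L N) / β) := by
        have : 1 / ((N : ℝ) * L N) = 1 - β := by
          rw [hβdef]
          ring
        rw [this]
        field_simp
        ring
      have h3 : (m : ℝ) * (1 / (N * L N) / β) ≤ (1 + b) / 2 * Real.log N := by
        calc (m : ℝ) * (1 / (N * L N) / β) ≤ b * coverScale L N * (1 / (N * L N) / β) :=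
              mul_le_mul_of_nonneg_right hm (by positivity)
          _ = b / β * Real.log N := by
              rw [coverScale]
              field_simp
          _ ≤ _ := mul_le_mul_of_nonneg_right hbβ hlog
      have h4 := mul_le_mul_of_nonneg_left h1 (Nat.cast_nonneg (α := ℝ) m)
      rw [h2] at h4
      linarith
    calc 1 / ((N : ℝ) * β ^ m) ≤ 1 / (N * Real.exp (-((1 + b) / 2 * Real.log N))) := by gcongr
      _ = 1 / (Real.exp (Real.log N) * Real.exp (-((1 + b) / 2 * Real.log N))) := by
          rw [Real.exp_log (by linarith)]
      _ = Real.exp (-((1 - b) / 2 * Real.log N)) := by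
          rw [← Real.exp_add, one_div, ← Real.exp_neg]
          ring_nf

end Limit

/-! ### The limit, squeezed between `b > 1` and `b < 1`. -/

theorem theorem5p5 {Ω : ℕ → Type*} [∀ N, MeasurableSpace (Ω N)] (μ : ∀ N, Measure (Ω N))
    [∀ N, IsProbabilityMeasure (μ N)] (S : ∀ N, ℕ → Ω N → SpiderVertex N)
    (hS : ∀ N, 1 ≤ N → IsSpiderWalk (fun _ : Fin N => 1 / (N : ℝ)) (μ N) (S N))
    (c : ℝ) (hc : 0 < c) (k : ℕ) (hk : 1 ≤ k) (L : ℕ → ℕ)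
    (hL : ∀ᶠ N : ℕ in atTop, 1 ≤ L N ∧ (L N : ℝ) ≤ (N : ℝ) / Real.log N) :
    Tendsto
      (fun N : ℕ => (μ N).real
        (spiderVisitEvent (S N) ⌊(c * (L N : ℝ) * (N : ℝ) * Real.log N) ^ 2⌋₊ (L N) k))
      atTop (𝓝 ((gaussianReal 0 1).real {z : ℝ | 1 / c < |z|})) := by
  have hL1 : ∀ᶠ N in atTop, 1 ≤ L N := hL.mono fun N h => h.1
  have hT := tendsto_coverScale hL1
  have hscale : ∀ N : ℕ, c * (L N : ℝ) * (N : ℝ) * Real.log N = c * coverScale L N := by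
    intro N
    rw [coverScale]
    ring
  simp only [hscale]
  set G : ℝ → ℝ := fun b => (gaussianReal 0 1).real {z : ℝ | b / c < |z|} with hG
  have hGcont : ContinuousAt G 1 :=
    (continuousAt_gaussianReal_real_lt_abs (1 / c)).comp
      (f := fun b : ℝ => b / c) (continuous_id.div_const c).continuousAt
  change Tendsto _ atTop (𝓝 (G 1))
  refine tendsto_order.2 ⟨fun a ha => ?_, fun a ha => ?_⟩
  · obtain ⟨b, hab, hb⟩ : ∃ b, a < G b ∧ 1 < b :=
      ((hGcont.eventually (lt_mem_nhds ha)).filter_mono nhdsWithin_le_nhds |>.and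
        (self_mem_nhdsWithin (s := Set.Ioi 1))).exists
    have hb0 : 0 < b := by linarith
    obtain ⟨θ, hθ0, hθ1, hθ⟩ : ∃ θ : ℝ, 0 < θ ∧ θ < 1 ∧ 1 < (1 - θ) * b := by
      -- This `θ` puts `(1 - θ) * b` halfway between `1` and `b`.
      refine ⟨(b - 1) / (2 * b), div_pos (by linarith) (by linarith), ?_, ?_⟩
      · rw [div_lt_one (by linarith)]
        linarith
      · have : (1 - (b - 1) / (2 * b)) * b = (b + 1) / 2 := by
          field_simp
          ring
        rw [this]
        linarith
    have hlim := (tendsto_srwMaxTail_floor hT hb0 hc).sub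
      (tendsto_many_excursions hL1 hθ0 hθ1 hθ (θ ^ (k + 1))⁻¹ (by positivity))
    rw [sub_zero] at hlim
    filter_upwards [hlim.eventually (lt_mem_nhds hab), hL1, eventually_ge_atTop 1,
      (floor_scaling hT hb0 hc).2.1] with N h1 h2 h3 h4
    exact h1.trans_le (le_measureReal_spiderVisitEvent (by omega) (hS N h3) k h2 h4 hθ0 hθ1.le)
  · obtain ⟨b, hab, hb, hb0⟩ : ∃ b, G b < a ∧ b < 1 ∧ 0 < b :=
      ((hGcont.eventually (gt_mem_nhds ha)).filter_mono nhdsWithin_le_nhds |>.and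
        ((eventually_mem_nhdsWithin (s := Set.Iio (1 : ℝ))).and
          ((lt_mem_nhds one_pos).filter_mono nhdsWithin_le_nhds))).exists
    have hlim := (tendsto_srwMaxTail_floor hT hb0 hc).add (tendsto_few_excursions hL1 hb0 hb)
    rw [add_zero] at hlim
    filter_upwards [hlim.eventually (gt_mem_nhds hab), hL1, eventually_ge_atTop 2,
      (floor_scaling hT hb0 hc).2.1] with N h1 h2 h3 h4
    exact (measureReal_spiderVisitEvent_le (by omega) (hS N (by omega)) h2 hk h4
      (one_sub_inv_pos h3 h2).2).trans_lt h1
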